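/- Let $\mathbb{N}$ denote the set of positive integers. For $\mathbf{k}=(k_1,\dots,k_r)\in\mathbb{N}^r$ put $|\mathbf{k}|=k_1+\cdots+k_r$ and, for integers $n\ge 0$, $$t_n(\mathbf{k})=\sum_{n\ge n_1>\cdots>n_r>0}\ \prod_{j=1}^r\frac{1}{(2n_j-1)^{k_j}},$$ with $t_n(\emptyset)=1$ and $|\emptyset|=0$. For integers $N,w\ge 1$, let $\mathsf{CMZV}^N_w\subset\mathbb{C}$ be the $\mathbb{Q}$-linear span of all colored multiple zeta values of level $N$ and weight $w$, that is, of all numbers $$\mathrm{Li}_{s_1,\dots,s_d}(z_1,\dots,z_d)=\lim_{M\to\infty}\ \sum_{M\ge n_1>\cdots>n_d>0}\frac{z_1^{n_1}\cdots z_d^{n_d}}{n_1^{s_1}\cdots n_d^{s_d}},$$ where $d\ge 1$, $(s_1,\dots,s_d)\in\mathbb{N}^d$ with $s_1+\cdots+s_d=w$, each $z_j$ is an $N$th root of unity, and $(s_1,z_1)\ne(1,1)$. Let $m\in\mathbb{N}$, and let $\mathbf{k}\in\mathbb{N}^r$ for some $r\in\mathbb{N}$, or $\mathbf{k}=\emptyset$.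 Then the following two series converge, and $$\sum_{n=0}^\infty\frac{1}{4^n}\binom{2n}{n}\frac{t_n(\mathbf{k})}{(2n+1)^m}\in i\,\mathsf{CMZV}^4_{|\mathbf{k}|+m},\qquad \sum_{n=1}^\infty\frac{4^n}{\binom{2n}{n}}\,\frac{t_n(\mathbf{k})}{n^{m+1}}\in\mathsf{CMZV}^4_{|\mathbf{k}|+m+1}.$$ (If $\mathbf{k}\ne\emptyset$, the $n=0$ term of the first series vanishes, so the sum may equally be started at $n=1$.) -/

import Mathlib

/-- The multiple `t`-harmonic sum
`t_n(k₁, …, k_r) = ∑_{n ≥ n₁ > ⋯ > n_r > 0} ∏_j 1 / (2 n_j - 1) ^ k_j`, with `t_n(∅) = 1`,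
computed by summing over the largest index `n₁` first: the remaining indices run below `n₁`,
that is, up to `n₁ - 1`. The index `n₁` is written `a + 1` with `0 ≤ a < n`, so that
`2 n₁ - 1 = 2 a + 1` and `n₁ - 1 = a`. -/
noncomputable def multipleTSum : List ℕ → ℕ → ℝ
  | [], _ => 1
  | k :: ks, n => ∑ a ∈ Finset.range n, 1 / (2 * (a : ℝ) + 1) ^ k * multipleTSum ks a

/-- The truncated multiple polylogarithm
`∑_{M ≥ n₁ > ⋯ > n_r > 0} ∏_j z_j ^ n_j / n_j ^ k_j` of the list `(k₁, z₁), …, (k_r, z_r)`,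
computed by summing over the largest index `n₁ = a + 1` first. -/
noncomputable def truncatedLi : List (ℕ × ℂ) → ℕ → ℂ
  | [], _ => 1
  | (k, z) :: s, M =>
      ∑ a ∈ Finset.range M, z ^ (a + 1) / ((a : ℂ) + 1) ^ k * truncatedLi s a

/-- `x` is a colored multiple zeta value `Li_{k₁, …, k_r}(z₁, …, z_r)` of level `N` and weight `w`:
the `k_j` are positive integers of sum `w`, the `z_j` are `N`th roots of unity,
`(k₁, z₁) ≠ (1, 1)`, and `x` is the sum of the (possibly only conditionally convergent) series
over `n₁ > ⋯ > n_r > 0`, that is, the limit of its truncations at `n₁ ≤ M`. -/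
def IsColoredMZV (N w : ℕ) (x : ℂ) : Prop :=
  ∃ s : List (ℕ × ℂ),
    (∀ p ∈ s, 0 < p.1 ∧ p.2 ^ N = 1) ∧
    s.head? ≠ some (1, 1) ∧
    (s.map Prod.fst).sum = w ∧
    Filter.Tendsto (fun M : ℕ => truncatedLi s M) Filter.atTop (nhds x)

/-- The `ℚ`-span of all colored multiple zeta values of level `N` and weight `w`. -/
noncomputable def CMZV (N w : ℕ) : Submodule ℚ ℂ :=
  Submodule.span ℚ {x : ℂ | IsColoredMZV N w x}

/-!
Write `x = 2 t / (1 + t²)`, so that `√(1 - x²) = (1 - t²) / (1 + t²)`. Replace `1` by `x` in the two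
series: each becomes a power series in `x` whose value at `x = 1` is wanted. Dividing the `n`th
term of such a series by `2 n + 1` or `2 n + 2` amounts to an integration against `dx / x`, and the
recurrences of `binom(2n, n) / 4 ^ n`, of its reciprocal and of `t_n(k)` turn the removal of the first
entry of `k` into a first order differential equation `(1 - x²) G' = x G + …`, which the factor
`√(1 - x²)` integrates (`hasDerivAt_cosSubst_mul_evenSeries` and
`hasDerivAt_cosSubst_mul_sinSubst_mul_evenSeries`). Hence both generating functions are iterated
integrals of the forms `dx / x`, `dx / √(1 - x²)`, `x dx / (1 - x²)`, `dx / (x √(1 - x²))` and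
`dx / (x (1 - x²))`. In the variable `t` these are combinations of `dt / t` and
`σ dt / (1 - σ t)` with `σ⁴ = 1`; the coefficients are rational except in
`dx / √(1 - x²) = 2 dt / (1 + t²)`, which is `i` times a rational combination. This form occurs an
odd number of times in the first series and an even number of times in the second one, which
accounts for the factor `i`.

The rational span of the one-variable multiple polylogarithms
`∑ t ^ n₁ ∏ z_j ^ n_j / n_j ^ k_j` with `z_j ^ N = 1` is closed under integration against `dt / t` and
`σ dt / (1 - σ t)` where `σ ^ N = 1`, and the weight goes up by one (`inv_mul_mem_primitivesIn`,
`kernel_mul_mem_primitivesIn`). If the last integration is not against `dt / (1 - t)`, only lists with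
`(k₁, z₁) ≠ (1, 1)` occur. Their series converge at `t = 1` (`exists_tendsto_truncatedLi`), and by
Abel's theorem the limit of the function at `1` lies in the span of the colored multiple zeta values
(`exists_tendsto_one_of_mem_polylogSpan`). As the coefficients of the two series are nonnegative,
the existence of this limit also gives their convergence, with the same value
(`hasSum_of_tendsto_pow_mul_evenSeries`).
-/

open Set Filter Topology

/-! ### Power series with polynomially bounded coefficients -/

/-- A sequence of at most polynomial growth. -/
def PolyBounded {E : Type*} [NormedAddCommGroup E] (u : ℕ → E) : Prop :=
  ∃ (C : ℝ) (p : ℕ), ∀ n, ‖u n‖ ≤ C * ((n : ℝ) + 1) ^ p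

section PowerSeries

variable {E : Type*} [NormedAddCommGroup E]

theorem summable_succ_pow_mul_geometric (p : ℕ) {r : ℝ} (h0 : 0 < r) (h1 : r < 1) :
    Summable fun n : ℕ => ((n : ℝ) + 1) ^ p * r ^ n := by
  have h := summable_pow_mul_geometric_of_norm_lt_one p (r := r)
    (by rwa [Real.norm_of_nonneg h0.le])
  have h2 := ((summable_nat_add_iff 1).2 h).mul_left r⁻¹
  refine h2.congr fun n => ?_
  push_cast
  field_simp
  ring

theorem PolyBounded.mono {F : Type*} [NormedAddCommGroup F] {u : ℕ → E} {v : ℕ → F}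
    (hu : PolyBounded u) (h : ∀ n, ‖v n‖ ≤ ‖u n‖) : PolyBounded v := by
  obtain ⟨C, p, hC⟩ := hu
  exact ⟨C, p, fun n => (h n).trans (hC n)⟩

theorem PolyBounded.mul {u v : ℕ → ℝ} (hu : PolyBounded u) (hv : PolyBounded v) :
    PolyBounded fun n => u n * v n := by
  obtain ⟨C, p, hC⟩ := hu
  obtain ⟨D, q, hD⟩ := hv
  refine ⟨C * D, p + q, fun n => ?_⟩
  rw [norm_mul]
  calc ‖u n‖ * ‖v n‖ ≤ (C * ((n : ℝ) + 1) ^ p) * (D * ((n : ℝ) + 1) ^ q) :=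
        mul_le_mul (hC n) (hD n) (norm_nonneg _) ((norm_nonneg _).trans (hC n))
    _ = _ := by ring

theorem PolyBounded.add {u v : ℕ → E} (hu : PolyBounded u) (hv : PolyBounded v) :
    PolyBounded fun n => u n + v n := by
  obtain ⟨C, p, hC⟩ := hu
  obtain ⟨D, q, hD⟩ := hv
  have hC0 : 0 ≤ C := by have := (norm_nonneg _).trans (hC 0); simpa using this
  have hD0 : 0 ≤ D := by have := (norm_nonneg _).trans (hD 0); simpa using this
  refine ⟨C + D, p + q, fun n => (norm_add_le _ _).trans ?_⟩
  have h1 : (1 : ℝ) ≤ (n : ℝ) + 1 := by linarith [n.cast_nonneg (α := ℝ)]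
  have h2 : ((n : ℝ) + 1) ^ p ≤ ((n : ℝ) + 1) ^ (p + q) := pow_le_pow_right₀ h1 (by lia)
  have h3 : ((n : ℝ) + 1) ^ q ≤ ((n : ℝ) + 1) ^ (p + q) := pow_le_pow_right₀ h1 (by lia)
  have := hC n
  have := hD n
  nlinarith [mul_le_mul_of_nonneg_left h2 hC0, mul_le_mul_of_nonneg_left h3 hD0]

theorem PolyBounded.comp_succ {u : ℕ → E} (hu : PolyBounded u) :
    PolyBounded fun n => u (n + 1) := by
  obtain ⟨C, p, hC⟩ := hu
  have hC0 : 0 ≤ C := by have := (norm_nonneg _).trans (hC 0); simpa using this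
  refine ⟨C * 2 ^ p, p, fun n => (hC (n + 1)).trans ?_⟩
  rw [mul_assoc, ← mul_pow]
  gcongr
  push_cast
  linarith [n.cast_nonneg (α := ℝ)]

theorem polyBounded_const (c : E) : PolyBounded fun _ : ℕ => c :=
  ⟨‖c‖, 0, fun n => by simp⟩

theorem polyBounded_linear (b : ℝ) : PolyBounded fun n : ℕ => 2 * (n : ℝ) + b := by
  refine ⟨2 + |b|, 1, fun n => ?_⟩
  have hn := n.cast_nonneg (α := ℝ)
  rw [Real.norm_eq_abs, pow_one]
  calc |2 * (n : ℝ) + b| ≤ |2 * (n : ℝ)| + |b| := abs_add_le _ _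
    _ = 2 * n + |b| := by rw [abs_of_nonneg (by positivity)]
    _ ≤ _ := by nlinarith [abs_nonneg b]

variable [NormedSpace ℝ E]

theorem PolyBounded.norm_pow_smul_le {u : ℕ → E} {C : ℝ} {p : ℕ}
    (hC : ∀ n, ‖u n‖ ≤ C * ((n : ℝ) + 1) ^ p) {x r : ℝ} (hx : |x| ≤ r) (h1 : r ≤ 1) {m n : ℕ}
    (hmn : n ≤ m) : ‖x ^ m • u n‖ ≤ C * (((n : ℝ) + 1) ^ p * r ^ n) := by
  rw [norm_smul, norm_pow, Real.norm_eq_abs]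
  have h2 : |x| ^ m ≤ r ^ n :=
    (pow_le_pow_left₀ (abs_nonneg x) hx m).trans
      (pow_le_pow_of_le_one ((abs_nonneg x).trans hx) h1 hmn)
  calc |x| ^ m * ‖u n‖ ≤ r ^ n * (C * ((n : ℝ) + 1) ^ p) :=
        mul_le_mul h2 (hC n) (norm_nonneg _) (pow_nonneg ((abs_nonneg x).trans hx) _)
    _ = _ := by ring

theorem PolyBounded.summable_pow_smul [CompleteSpace E] {u : ℕ → E} (hu : PolyBounded u)
    {e : ℕ → ℕ} (he : ∀ n, n ≤ e n) {x : ℝ} (hx : |x| < 1) :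
    Summable fun n => x ^ e n • u n := by
  obtain ⟨C, p, hC⟩ := hu
  obtain ⟨r, hr, hr1⟩ := exists_between hx
  have hr0 : 0 < r := (abs_nonneg x).trans_lt hr
  exact Summable.of_norm_bounded ((summable_succ_pow_mul_geometric p hr0 hr1).mul_left C)
    fun n => PolyBounded.norm_pow_smul_le hC hr.le hr1.le (he n)

theorem PolyBounded.hasDerivAt_tsum_pow_smul [CompleteSpace E] {u : ℕ → E} (hu : PolyBounded u)
    {e : ℕ → ℕ} (he : ∀ n, n ≤ e n) (he' : ∀ n, e n ≤ 2 * n + 1) {x : ℝ} (hx : |x| < 1) :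
    HasDerivAt (fun y : ℝ => ∑' n, y ^ (e n + 1) • u n)
      (∑' n, (((e n : ℝ) + 1) * x ^ e n) • u n) x := by
  have hsum : Summable fun n => x ^ (e n + 1) • u n :=
    hu.summable_pow_smul (e := fun n => e n + 1) (fun n => (he n).trans (by lia)) hx
  obtain ⟨C, p, hC⟩ := hu
  obtain ⟨r, hr, hr1⟩ := exists_between hx
  have hr0 : 0 < r := (abs_nonneg x).trans_lt hr
  have hC' : ∀ n, ‖((e n : ℝ) + 1) • u n‖ ≤ (2 * C) * ((n : ℝ) + 1) ^ (p + 1) := by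
    intro n
    rw [norm_smul, Real.norm_of_nonneg (by positivity), pow_succ]
    have h : (e n : ℝ) ≤ 2 * n + 1 := by exact_mod_cast he' n
    calc ((e n : ℝ) + 1) * ‖u n‖ ≤ (2 * (n : ℝ) + 2) * (C * ((n : ℝ) + 1) ^ p) :=
          mul_le_mul (by linarith) (hC n) (norm_nonneg _) (by positivity)
      _ = _ := by ring
  have hball : ∀ {y : ℝ}, y ∈ Metric.ball (0 : ℝ) r ↔ |y| < r := by
    intro y
    rw [mem_ball_zero_iff, Real.norm_eq_abs]
  refine hasDerivAt_tsum_of_isPreconnected (𝕜 := ℝ) (y₀ := x)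
    (g := fun n y => y ^ (e n + 1) • u n) (g' := fun n y => (((e n : ℝ) + 1) * y ^ e n) • u n)
    ((summable_succ_pow_mul_geometric (p + 1) hr0 hr1).mul_left (2 * C))
    Metric.isOpen_ball (convex_ball (0 : ℝ) r).isPreconnected (fun n y _ => ?_)
    (fun n y hy => ?_) (hball.2 hr) hsum (hball.2 hr)
  · have h := (hasDerivAt_pow (e n + 1) y).smul_const (u n)
    rw [Nat.cast_succ, Nat.add_sub_cancel] at h
    exact h
  · rw [mul_comm, mul_smul]
    exact PolyBounded.norm_pow_smul_le hC' (hball.1 hy).le hr1.le (he n)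

end PowerSeries

/-! ### Growth and convergence of the truncated multiple polylogarithms -/

/-- The lists of weight `w` with positive exponents and `N`th roots of unity as arguments. -/
def coloredIndices (N w : ℕ) : Set (List (ℕ × ℂ)) :=
  {s | (∀ p ∈ s, 0 < p.1 ∧ p.2 ^ N = 1) ∧ (s.map Prod.fst).sum = w}

/-- The lists in `coloredIndices N w` whose multiple polylogarithm converges at `1`. -/
def convergentIndices (N w : ℕ) : Set (List (ℕ × ℂ)) :=
  {s | s ∈ coloredIndices N w ∧ s.head? ≠ some (1, 1)}

theorem cons_mem_coloredIndices {N w k : ℕ} {z : ℂ} {s : List (ℕ × ℂ)} (hk : 0 < k)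
    (hz : z ^ N = 1) (hs : s ∈ coloredIndices N w) : (k, z) :: s ∈ coloredIndices N (k + w) := by
  refine ⟨fun p hp => ?_, by simp [hs.2]⟩
  rcases List.mem_cons.1 hp with rfl | hp
  · exact ⟨hk, hz⟩
  · exact hs.1 p hp

theorem truncatedLi_cons_succ (k : ℕ) (z : ℂ) (s : List (ℕ × ℂ)) (n : ℕ) :
    truncatedLi ((k, z) :: s) (n + 1) =
      truncatedLi ((k, z) :: s) n + z ^ (n + 1) / ((n : ℂ) + 1) ^ k * truncatedLi s n := by
  simp [truncatedLi, Finset.sum_range_succ]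

theorem sum_range_one_div_sqrt_le (M : ℕ) :
    ∑ a ∈ Finset.range M, 1 / √((a : ℝ) + 1) ≤ 2 * √M := by
  induction M with
  | zero => simp
  | succ M ih =>
    rw [Finset.sum_range_succ]
    push_cast
    have h1 : 0 < √((M : ℝ) + 1) := Real.sqrt_pos.2 (by positivity)
    have h2 := Real.sq_sqrt (show (0 : ℝ) ≤ (M : ℝ) + 1 by positivity)
    have h3 := Real.sq_sqrt (show (0 : ℝ) ≤ (M : ℝ) by positivity)
    have h4 : 1 / √((M : ℝ) + 1) ≤ 2 * √((M : ℝ) + 1) - 2 * √M := by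
      rw [div_le_iff₀ h1]
      nlinarith [sq_nonneg (√((M : ℝ) + 1) - √M)]
    linarith

theorem norm_natCast_add_one (a : ℕ) : ‖(a : ℂ) + 1‖ = (a : ℝ) + 1 := by
  rw [← Nat.cast_succ, Complex.norm_natCast, Nat.cast_succ]

theorem norm_truncatedLi_term {N : ℕ} (hN : N ≠ 0) {z : ℂ} (hz : z ^ N = 1) (k n : ℕ) (y : ℂ) :
    ‖z ^ (n + 1) / ((n : ℂ) + 1) ^ k * y‖ = ‖y‖ / ((n : ℝ) + 1) ^ k := by
  rw [norm_mul, norm_div, norm_pow, norm_pow, norm_natCast_add_one,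
    Complex.norm_eq_one_of_pow_eq_one hz hN]
  ring

/-- The truncations grow more slowly than any power of `M`; the exponent `1 / 2` suffices below. -/
theorem norm_truncatedLi_le {N : ℕ} (hN : N ≠ 0) (s : List (ℕ × ℂ))
    (hs : ∀ p ∈ s, 0 < p.1 ∧ p.2 ^ N = 1) (M : ℕ) :
    ‖truncatedLi s M‖ ≤ 2 ^ s.length * √((M : ℝ) + 1) := by
  induction s generalizing M with
  | nil => simp [truncatedLi]
  | cons p s ih =>
    obtain ⟨k, z⟩ := p
    obtain ⟨hk, hz⟩ := hs (k, z) (by simp)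
    have ih' := ih fun p hp => hs p (by simp [hp])
    simp only [truncatedLi, List.length_cons]
    calc ‖∑ a ∈ Finset.range M, z ^ (a + 1) / ((a : ℂ) + 1) ^ k * truncatedLi s a‖
        ≤ ∑ a ∈ Finset.range M, 2 ^ s.length * (1 / √((a : ℝ) + 1)) := by
          refine norm_sum_le_of_le _ fun a _ => ?_
          rw [norm_truncatedLi_term hN hz, div_le_iff₀ (by positivity)]
          have h1 : 0 < √((a : ℝ) + 1) := Real.sqrt_pos.2 (by positivity)
          have h2 := Real.sq_sqrt (show (0 : ℝ) ≤ (a : ℝ) + 1 by positivity)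
          have h3 : (a : ℝ) + 1 ≤ ((a : ℝ) + 1) ^ k :=
            le_self_pow₀ (by linarith [a.cast_nonneg (α := ℝ)]) hk.ne'
          calc ‖truncatedLi s a‖ ≤ 2 ^ s.length * √((a : ℝ) + 1) := ih' a
            _ = 2 ^ s.length * (1 / √((a : ℝ) + 1)) * ((a : ℝ) + 1) := by
                nth_rewrite 3 [← h2]
                field_simp
            _ ≤ _ := by gcongr
      _ ≤ 2 ^ s.length * (2 * √M) := by
          rw [← Finset.mul_sum]
          gcongr
          exact sum_range_one_div_sqrt_le M
      _ ≤ 2 ^ s.length * (2 * √((M : ℝ) + 1)) := by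
          gcongr
          linarith
      _ = _ := by ring

theorem polyBounded_truncatedLi {N : ℕ} (hN : N ≠ 0) (s : List (ℕ × ℂ))
    (hs : ∀ p ∈ s, 0 < p.1 ∧ p.2 ^ N = 1) : PolyBounded (truncatedLi s) := by
  refine ⟨2 ^ s.length, 1, fun n => (norm_truncatedLi_le hN s hs n).trans ?_⟩
  rw [pow_one]
  gcongr
  rw [Real.sqrt_le_left (by positivity)]
  nlinarith [n.cast_nonneg (α := ℝ)]

theorem summable_sqrt_div_sq :
    Summable fun n : ℕ => √((n : ℝ) + 1) / ((n : ℝ) + 1) ^ 2 := by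
  have h := (Real.summable_one_div_nat_add_rpow 1 (3 / 2)).2 (by norm_num)
  refine h.congr fun n => ?_
  have h0 : (0 : ℝ) < (n : ℝ) + 1 := by positivity
  rw [abs_of_pos h0, Real.sqrt_eq_rpow, ← Real.rpow_natCast, ← Real.rpow_sub h0, one_div,
    ← Real.rpow_neg h0.le]
  norm_num

/-- A form of the Dirichlet test: the series `∑ z ^ (n + 1) v n` converges if `z ≠ 1` lies on the
unit circle and `v` is a null sequence of bounded variation. -/
theorem exists_tendsto_sum_pow_mul {z : ℂ} (hz : ‖z‖ = 1) (hz1 : z ≠ 1) {v : ℕ → ℂ}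
    (hv : Tendsto v atTop (𝓝 0)) (hv' : Summable fun n => ‖v (n + 1) - v n‖) :
    ∃ x, Tendsto (fun M => ∑ a ∈ Finset.range M, z ^ (a + 1) * v a) atTop (𝓝 x) := by
  have hz0 : z - 1 ≠ 0 := sub_ne_zero.2 hz1
  have key : ∀ M, ∑ a ∈ Finset.range M, z ^ (a + 1) * v a = (z - 1)⁻¹ *
      (z ^ (M + 1) * v M - z * v 0 -
        ∑ a ∈ Finset.range M, z ^ (a + 2) * (v (a + 1) - v a)) := by
    intro M
    rw [eq_inv_mul_iff_mul_eq₀ hz0]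
    induction M with
    | zero => simp
    | succ M ih =>
      rw [Finset.sum_range_succ, mul_add, ih, Finset.sum_range_succ]
      ring
  have h1 : Tendsto (fun M => z ^ (M + 1) * v M) atTop (𝓝 0) := by
    rw [tendsto_zero_iff_norm_tendsto_zero] at hv ⊢
    simpa [hz] using hv
  have h2 : Summable fun a => z ^ (a + 2) * (v (a + 1) - v a) := by
    refine Summable.of_norm ?_
    simpa [hz] using hv'
  refine ⟨_, Tendsto.congr (fun M => (key M).symm)
    (((h1.sub_const (z * v 0)).sub h2.hasSum.tendsto_sum_nat).const_mul (z - 1)⁻¹)⟩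

/-- The series of a colored multiple zeta value converges as soon as `(k₁, z₁) ≠ (1, 1)`. -/
theorem exists_tendsto_truncatedLi {N w : ℕ} (hN : N ≠ 0) {s : List (ℕ × ℂ)}
    (hs : s ∈ convergentIndices N w) : ∃ x, Tendsto (truncatedLi s) atTop (𝓝 x) := by
  obtain ⟨⟨hs, -⟩, hd⟩ := hs
  match s with
  | [] => exact ⟨1, tendsto_const_nhds⟩
  | (k, z) :: s =>
    obtain ⟨hk, hz⟩ := hs (k, z) (by simp)
    have hs' : ∀ p ∈ s, 0 < p.1 ∧ p.2 ^ N = 1 := fun p hp => hs p (by simp [hp])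
    have hb := norm_truncatedLi_le hN s hs'
    rcases Nat.lt_or_ge 1 k with h2 | h2
    · have h : Summable fun a : ℕ => z ^ (a + 1) / ((a : ℂ) + 1) ^ k * truncatedLi s a := by
        refine Summable.of_norm_bounded (summable_sqrt_div_sq.mul_left (2 ^ s.length)) fun n => ?_
        rw [norm_truncatedLi_term hN hz, ← mul_div_assoc]
        gcongr
        · exact hb n
        · linarith [n.cast_nonneg (α := ℝ)]
        · lia
      exact ⟨_, h.hasSum.tendsto_sum_nat⟩
    · obtain rfl : k = 1 := by lia
      have hz1 : z ≠ 1 := by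
        rintro rfl
        simp at hd
      have hz' := Complex.norm_eq_one_of_pow_eq_one hz hN
      set v : ℕ → ℂ := fun a => truncatedLi s a / ((a : ℂ) + 1) with hv
      have hne : ∀ n : ℕ, (n : ℂ) + 1 ≠ 0 := fun n => Nat.cast_add_one_ne_zero n
      have hv0 : Tendsto v atTop (𝓝 0) := by
        have h : Tendsto (fun n : ℕ => 2 ^ s.length * (√((n : ℝ) + 1) / ((n : ℝ) + 1)))
            atTop (𝓝 0) := by
          have h3 : Tendsto (fun n : ℕ => √((n : ℝ) + 1)) atTop atTop :=
            Real.tendsto_sqrt_atTop.comp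
              (tendsto_atTop_add_const_right _ _ tendsto_natCast_atTop_atTop)
          simpa [Real.sqrt_div_self'] using (h3.inv_tendsto_atTop).const_mul (2 ^ s.length : ℝ)
        refine squeeze_zero_norm (fun n => ?_) h
        rw [hv, norm_div, norm_natCast_add_one, ← mul_div_assoc]
        gcongr
        exact hb n
      -- The increment of the truncation at `n` is `O(√n / n)`.
      have hinc : ∀ n, ‖truncatedLi s (n + 1) - truncatedLi s n‖ ≤
          2 ^ s.length * (√((n : ℝ) + 1) / ((n : ℝ) + 1)) := by
        intro n
        match s, hs' with
        | [], _ =>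
          simp only [truncatedLi, sub_self, norm_zero]
          positivity
        | (j, y) :: s', hs' =>
          obtain ⟨hj, hy⟩ := hs' (j, y) (by simp)
          rw [truncatedLi_cons_succ, add_sub_cancel_left, norm_truncatedLi_term hN hy,
            ← mul_div_assoc]
          have h3 := norm_truncatedLi_le hN s' (fun p hp => hs' p (by simp [hp])) n
          have h4 : (n : ℝ) + 1 ≤ ((n : ℝ) + 1) ^ j :=
            le_self_pow₀ (by linarith [n.cast_nonneg (α := ℝ)]) hj.ne'
          gcongr
          refine h3.trans ?_
          gcongr
          · norm_num
          · simp
      have hv1 : Summable fun n => ‖v (n + 1) - v n‖ := by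
        refine Summable.of_nonneg_of_le (fun _ => norm_nonneg _) (fun n => ?_)
          (summable_sqrt_div_sq.mul_left (2 * 2 ^ s.length))
        have h5 : v (n + 1) - v n = (truncatedLi s (n + 1) - truncatedLi s n) / ((n : ℂ) + 1 + 1)
            - truncatedLi s n / (((n : ℂ) + 1) * ((n : ℂ) + 1 + 1)) := by
          have := hne n
          have := hne (n + 1)
          simp only [hv]
          push_cast at this ⊢
          field_simp
          ring
        have hn : ‖(n : ℂ) + 1 + 1‖ = (n : ℝ) + 1 + 1 := by
          have := norm_natCast_add_one (n + 1)
          push_cast at this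
          exact this
        rw [h5]
        refine (norm_sub_le _ _).trans ?_
        rw [norm_div, norm_div, norm_mul, hn, norm_natCast_add_one]
        have h6 : (n : ℝ) + 1 ≤ (n : ℝ) + 1 + 1 := by linarith
        calc _ ≤ 2 ^ s.length * (√((n : ℝ) + 1) / ((n : ℝ) + 1)) / ((n : ℝ) + 1) +
              2 ^ s.length * √((n : ℝ) + 1) / (((n : ℝ) + 1) * ((n : ℝ) + 1)) := by
              gcongr
              · exact hinc n
              · exact hb n
          _ = _ := by
              field_simp
              ring
      obtain ⟨x, hx⟩ := exists_tendsto_sum_pow_mul hz' hz1 hv0 hv1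
      refine ⟨x, hx.congr fun M => Finset.sum_congr rfl fun a _ => ?_⟩
      simp only [hv]
      ring

/-! ### Multiple polylogarithms as functions on the unit interval -/

/-- The multiple polylogarithm of the list `(k₁, z₁), …, (k_r, z_r)` in one variable,
`t ↦ ∑_{n₁ > ⋯ > n_r > 0} t ^ n₁ ∏_j z_j ^ n_j / n_j ^ k_j`. -/
noncomputable def polylog : List (ℕ × ℂ) → ℝ → ℂ
  | [], _ => 1
  | (k, z) :: s, t =>
      ∑' n : ℕ, t ^ (n + 1) • (z ^ (n + 1) / ((n : ℂ) + 1) ^ k * truncatedLi s n)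

theorem polyBounded_polylog_coeff {N : ℕ} (hN : N ≠ 0) {z : ℂ} (hz : z ^ N = 1)
    {s : List (ℕ × ℂ)} (hs : ∀ p ∈ s, 0 < p.1 ∧ p.2 ^ N = 1) (k : ℕ) :
    PolyBounded fun n : ℕ => z ^ (n + 1) / ((n : ℂ) + 1) ^ k * truncatedLi s n := by
  refine (polyBounded_truncatedLi hN s hs).mono fun n => ?_
  rw [norm_truncatedLi_term hN hz]
  exact div_le_self (norm_nonneg _) (one_le_pow₀ (by linarith [n.cast_nonneg (α := ℝ)]))

/-- Differentiating a multiple polylogarithm lowers its first exponent by one. -/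
theorem hasDerivAt_polylog_cons {N : ℕ} (hN : N ≠ 0) {z : ℂ} (hz : z ^ N = 1)
    {s : List (ℕ × ℂ)} (hs : ∀ p ∈ s, 0 < p.1 ∧ p.2 ^ N = 1) (k : ℕ) {t : ℝ} (ht : |t| < 1) :
    HasDerivAt (polylog ((k + 1, z) :: s))
      (∑' n : ℕ, t ^ n • (z ^ (n + 1) / ((n : ℂ) + 1) ^ k * truncatedLi s n)) t := by
  have h := (polyBounded_polylog_coeff hN hz hs (k + 1)).hasDerivAt_tsum_pow_smul
    (e := fun n => n) (fun n => le_rfl) (fun n => by lia) ht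
  refine HasDerivAt.congr_deriv (f := polylog ((k + 1, z) :: s)) h (tsum_congr fun n => ?_)
  have := Nat.cast_add_one_ne_zero (R := ℂ) n
  simp only [Complex.real_smul]
  push_cast
  field_simp
  ring

theorem hasDerivAt_polylog_succ {N : ℕ} (hN : N ≠ 0) {z : ℂ} (hz : z ^ N = 1)
    {s : List (ℕ × ℂ)} (hs : ∀ p ∈ s, 0 < p.1 ∧ p.2 ^ N = 1) (k : ℕ) {t : ℝ} (ht : |t| < 1)
    (h0 : t ≠ 0) :
    HasDerivAt (polylog ((k + 1, z) :: s)) (polylog ((k, z) :: s) t / t) t := by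
  refine (hasDerivAt_polylog_cons hN hz hs k ht).congr_deriv ?_
  have h0' : (t : ℂ) ≠ 0 := by exact_mod_cast h0
  rw [eq_div_iff h0', polylog, ← tsum_mul_right]
  refine tsum_congr fun n => ?_
  simp only [Complex.real_smul]
  push_cast
  ring

theorem one_sub_mul_ne_zero {σ : ℂ} (hσ : ‖σ‖ = 1) {t : ℝ} (ht : |t| < 1) :
    1 - σ * t ≠ 0 := by
  intro h
  have h1 : ‖σ * (t : ℂ)‖ = 1 := by rw [← sub_eq_zero.1 h, norm_one]
  rw [norm_mul, hσ, one_mul, Complex.norm_real, Real.norm_eq_abs] at h1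
  linarith

/-- `twist σ s` is the list of a primitive of `σ / (1 - σ t) * polylog s t`. -/
noncomputable def twist (σ : ℂ) : List (ℕ × ℂ) → List (ℕ × ℂ)
  | [] => [(1, σ)]
  | (k, z) :: s => (1, σ) :: (k, z / σ) :: s

theorem twist_mem {N w : ℕ} {σ : ℂ} (hσ : σ ^ N = 1) {s : List (ℕ × ℂ)}
    (hs : s ∈ coloredIndices N w) : twist σ s ∈ coloredIndices N (w + 1) := by
  rw [add_comm]
  match s, hs with
  | [], hs => exact cons_mem_coloredIndices one_pos hσ hs
  | (k, z) :: s, hs =>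
    refine cons_mem_coloredIndices one_pos hσ ⟨fun p hp => ?_, by simpa using hs.2⟩
    have h := hs.1 (k, z) (by simp)
    rcases List.mem_cons.1 hp with rfl | hp
    · exact ⟨h.1, by rw [div_pow, hσ, h.2, div_one]⟩
    · exact hs.1 p (by simp [hp])

theorem hasDerivAt_twist {N w : ℕ} (hN : N ≠ 0) {σ : ℂ} (hσ : σ ^ N = 1) {s : List (ℕ × ℂ)}
    (hs : s ∈ coloredIndices N w) {t : ℝ} (ht : |t| < 1) :
    HasDerivAt (polylog (twist σ s)) (σ / (1 - σ * t) * polylog s t) t := by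
  have hσ1 := Complex.norm_eq_one_of_pow_eq_one hσ hN
  have hne := one_sub_mul_ne_zero hσ1 ht
  have hσ0 : σ ≠ 0 := by
    rintro rfl
    simp at hσ1
  match s, hs with
  | [], hs =>
    refine (hasDerivAt_polylog_cons hN hσ hs.1 0 ht).congr_deriv ?_
    have hn : ‖σ * (t : ℂ)‖ < 1 := by
      rwa [norm_mul, hσ1, one_mul, Complex.norm_real, Real.norm_eq_abs]
    have h := (hasSum_geometric_of_norm_lt_one hn).mul_left σ
    rw [polylog, mul_one, div_eq_mul_inv, ← h.tsum_eq]
    refine tsum_congr fun n => ?_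
    simp only [Complex.real_smul, truncatedLi]
    push_cast
    ring
  | (k, z) :: s, hs =>
    have htw : ∀ p ∈ (k, z / σ) :: s, 0 < p.1 ∧ p.2 ^ N = 1 :=
      fun p hp => (twist_mem hσ hs).1 p (by simp only [twist, List.mem_cons] at hp ⊢; tauto)
    refine (hasDerivAt_polylog_cons hN hσ htw 0 ht).congr_deriv ?_
    have hz := (hs.1 (k, z) (by simp)).2
    have hb := (polyBounded_polylog_coeff hN hσ htw 0).summable_pow_smul
      (e := fun n => n) (fun n => le_rfl) ht
    have hc := (polyBounded_polylog_coeff hN hz (fun p hp => hs.1 p (List.mem_cons_of_mem _ hp)) k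
      ).summable_pow_smul (e := fun n => n + 1) (fun n => by lia) ht
    -- Both sides are multiplied by `1 - σ t`; the coefficients of the left-hand side telescope.
    rw [div_mul_eq_mul_div, eq_div_iff hne, mul_sub, mul_one, polylog, ← tsum_mul_left,
      ← tsum_mul_right]
    have hb' := hb.mul_right (σ * (t : ℂ))
    rw [hb.tsum_eq_zero_add, sub_eq_iff_eq_add, ← (hc.mul_left σ).tsum_add hb']
    simp only [truncatedLi_cons_succ]
    simp only [truncatedLi, Finset.range_zero, Finset.sum_empty, mul_zero, smul_zero, zero_add]
    refine tsum_congr fun n => ?_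
    simp only [Complex.real_smul, div_pow]
    have := Nat.cast_add_one_ne_zero (R := ℂ) n
    push_cast
    field_simp
    ring

theorem tendsto_polylog_zero {N w : ℕ} (hN : N ≠ 0) {s : List (ℕ × ℂ)}
    (hs : s ∈ coloredIndices N (w + 1)) : Tendsto (polylog s) (𝓝[>] 0) (𝓝 0) := by
  match s, hs with
  | [], hs => exact absurd hs.2 (by simp)
  | (k, z) :: s, hs =>
    obtain ⟨hk, hz⟩ := hs.1 (k, z) (by simp)
    obtain ⟨k, rfl⟩ : ∃ j, k = j + 1 := ⟨k - 1, by lia⟩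
    have h := (hasDerivAt_polylog_cons hN hz (fun p hp => hs.1 p (List.mem_cons_of_mem _ hp)) k
      (t := 0) (by simp)).continuousAt.tendsto
    have h0 : polylog ((k + 1, z) :: s) 0 = 0 := by simp [polylog]
    rw [h0] at h
    exact h.mono_left nhdsWithin_le_nhds

/-- Abel's limit theorem for multiple polylogarithms. -/
theorem tendsto_polylog_one {s : List (ℕ × ℂ)} {x : ℂ}
    (hx : Tendsto (truncatedLi s) atTop (𝓝 x)) : Tendsto (polylog s) (𝓝[<] 1) (𝓝 x) := by
  match s with
  | [] =>
    have h : x = 1 := tendsto_nhds_unique hx tendsto_const_nhds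
    rw [h]
    exact tendsto_const_nhds
  | (k, z) :: s =>
    have h := Complex.tendsto_tsum_powerSeries_nhdsWithin_lt
      (f := fun n : ℕ => z ^ (n + 1) / ((n : ℂ) + 1) ^ k * truncatedLi s n) hx
    rw [tendsto_map'_iff] at h
    have h1 : Tendsto (fun t : ℝ => (t : ℂ)) (𝓝[<] 1) (𝓝 1) := by
      have := (Complex.continuous_ofReal.tendsto (1 : ℝ)).mono_left
        (nhdsWithin_le_nhds (s := Iio 1))
      simpa using this
    have h2 := h1.mul h
    rw [one_mul] at h2
    refine h2.congr fun t => ?_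
    rw [polylog, Function.comp, ← tsum_mul_left]
    refine tsum_congr fun n => ?_
    simp only [Complex.real_smul]
    push_cast
    ring

/-! ### Spans of multiple polylogarithms and their primitives -/

/-- The functions that agree on `(0, 1)` with a rational linear combination of the multiple
polylogarithms of the lists in `C`: they are spanned by these and the functions vanishing
on `(0, 1)`. -/
noncomputable def polylogSpan (C : Set (List (ℕ × ℂ))) : Submodule ℚ (ℝ → ℂ) :=
  Submodule.span ℚ (polylog '' C ∪ {f | EqOn f 0 (Ioo 0 1)})

theorem polylogSpan_mono {C D : Set (List (ℕ × ℂ))} (h : C ⊆ D) :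
    polylogSpan C ≤ polylogSpan D :=
  Submodule.span_mono (union_subset_union_left _ (image_mono h))

theorem polylogSpan_congr {C : Set (List (ℕ × ℂ))} {f g : ℝ → ℂ} (hf : f ∈ polylogSpan C)
    (h : EqOn g f (Ioo 0 1)) : g ∈ polylogSpan C := by
  have h1 : g - f ∈ polylogSpan C :=
    Submodule.subset_span (Or.inr fun t ht => by simp [h ht])
  simpa using add_mem h1 hf

theorem convergentIndices_subset (N w : ℕ) : convergentIndices N w ⊆ coloredIndices N w :=
  fun _ h => h.1

/-- The functions on `(0, 1)` that have a primitive in `M`. -/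
noncomputable def primitivesIn (M : Submodule ℚ (ℝ → ℂ)) : Submodule ℚ (ℝ → ℂ) where
  carrier := {φ | ∃ g ∈ M, ∀ t ∈ Ioo (0 : ℝ) 1, HasDerivAt g (φ t) t}
  zero_mem' := ⟨0, M.zero_mem, fun t _ => hasDerivAt_const t (0 : ℂ)⟩
  add_mem' := by
    rintro φ ψ ⟨f, hf, hf'⟩ ⟨g, hg, hg'⟩
    exact ⟨f + g, M.add_mem hf hg, fun t ht => (hf' t ht).add (hg' t ht)⟩
  smul_mem' := by
    rintro q φ ⟨f, hf, hf'⟩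
    exact ⟨q • f, M.smul_mem q hf, fun t ht => (hf' t ht).const_smul q⟩

theorem primitivesIn_mono {M M' : Submodule ℚ (ℝ → ℂ)} (h : M ≤ M') :
    primitivesIn M ≤ primitivesIn M' :=
  fun _ ⟨g, hg, hg'⟩ => ⟨g, h hg, hg'⟩

theorem primitivesIn_congr {M : Submodule ℚ (ℝ → ℂ)} {φ ψ : ℝ → ℂ} (hφ : φ ∈ primitivesIn M)
    (h : EqOn ψ φ (Ioo 0 1)) : ψ ∈ primitivesIn M := by
  obtain ⟨g, hg, hg'⟩ := hφ
  exact ⟨g, hg, fun t ht => by rw [h ht]; exact hg' t ht⟩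

theorem mul_mem_primitivesIn {C D : Set (List (ℕ × ℂ))} {ω : ℝ → ℂ}
    (h : ∀ s ∈ C, (fun t => ω t * polylog s t) ∈ primitivesIn (polylogSpan D)) {f : ℝ → ℂ}
    (hf : f ∈ polylogSpan C) : (fun t => ω t * f t) ∈ primitivesIn (polylogSpan D) := by
  induction hf using Submodule.span_induction with
  | mem f hf =>
    rcases hf with ⟨s, hs, rfl⟩ | hf
    · exact h s hs
    · exact primitivesIn_congr (zero_mem _) fun t ht => by simp [hf ht]
  | zero => exact primitivesIn_congr (zero_mem _) fun t _ => by simp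
  | add f g _ _ hf hg => exact primitivesIn_congr (add_mem hf hg) fun t _ => by simp [mul_add]
  | smul q f _ hf => exact primitivesIn_congr (Submodule.smul_mem _ q hf) fun t _ => by simp

theorem abs_lt_one_of_mem_Ioo {t : ℝ} (ht : t ∈ Ioo (0 : ℝ) 1) : |t| < 1 := by
  rw [abs_of_pos ht.1]
  exact ht.2

/-- Integration against `dt / t` raises the weight by one and yields convergent lists. -/
theorem inv_mul_mem_primitivesIn {N w : ℕ} (hN : N ≠ 0) {f : ℝ → ℂ}
    (hf : f ∈ polylogSpan (coloredIndices N (w + 1))) :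
    (fun t : ℝ => (t : ℂ)⁻¹ * f t) ∈
      primitivesIn (polylogSpan (convergentIndices N (w + 2))) := by
  refine mul_mem_primitivesIn (fun s hs => ?_) hf
  match s, hs with
  | [], hs => exact absurd hs.2 (by simp)
  | (k, z) :: s, hs =>
    obtain ⟨hk, hz⟩ := hs.1 (k, z) (by simp)
    refine ⟨polylog ((k + 1, z) :: s), Submodule.subset_span (Or.inl ⟨_, ⟨⟨?_, ?_⟩, ?_⟩, rfl⟩),
      fun t ht => ?_⟩
    · intro p hp
      rcases List.mem_cons.1 hp with rfl | hp
      · exact ⟨k.succ_pos, hz⟩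
      · exact hs.1 p (by simp [hp])
    · have := hs.2
      simp only [List.map_cons, List.sum_cons] at this ⊢
      lia
    · simp only [List.head?_cons, ne_eq, Option.some.injEq, Prod.mk.injEq]
      lia
    · simp only [inv_mul_eq_div]
      exact hasDerivAt_polylog_succ hN hz (fun p hp => hs.1 p (List.mem_cons_of_mem _ hp)) k
        (abs_lt_one_of_mem_Ioo ht) ht.1.ne'

/-- Integration against `σ dt / (1 - σ t)`, where `σ ^ N = 1`, raises the weight by one. -/
theorem kernel_mul_mem_primitivesIn {N w : ℕ} (hN : N ≠ 0) {σ : ℂ} (hσ : σ ^ N = 1)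
    {f : ℝ → ℂ} (hf : f ∈ polylogSpan (coloredIndices N w)) :
    (fun t : ℝ => σ / (1 - σ * t) * f t) ∈
      primitivesIn (polylogSpan (coloredIndices N (w + 1))) :=
  mul_mem_primitivesIn (fun _ hs => ⟨_, Submodule.subset_span (Or.inl ⟨_, twist_mem hσ hs, rfl⟩),
    fun _ ht => hasDerivAt_twist hN hσ hs (abs_lt_one_of_mem_Ioo ht)⟩) hf

/-- Integration against `σ dt / (1 - σ t)` yields convergent lists if `σ ≠ 1`. -/
theorem kernel_mul_mem_primitivesIn_of_ne {N w : ℕ} (hN : N ≠ 0) {σ : ℂ} (hσ : σ ^ N = 1)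
    (hσ1 : σ ≠ 1) {f : ℝ → ℂ} (hf : f ∈ polylogSpan (coloredIndices N w)) :
    (fun t : ℝ => σ / (1 - σ * t) * f t) ∈
      primitivesIn (polylogSpan (convergentIndices N (w + 1))) := by
  refine mul_mem_primitivesIn (fun s hs => ?_) hf
  refine ⟨polylog (twist σ s), Submodule.subset_span (Or.inl ⟨_, ⟨twist_mem hσ hs, ?_⟩, rfl⟩),
    fun _ ht => hasDerivAt_twist hN hσ hs (abs_lt_one_of_mem_Ioo ht)⟩
  match s with
  | [] => simp [twist, hσ1]
  | (k, z) :: s => simp [twist, hσ1]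

theorem eqOn_of_hasDerivAt {f g φ : ℝ → ℂ} {c : ℂ}
    (hf : ∀ t ∈ Ioo (0 : ℝ) 1, HasDerivAt f (φ t) t)
    (hg : ∀ t ∈ Ioo (0 : ℝ) 1, HasDerivAt g (φ t) t)
    (hf0 : Tendsto f (𝓝[>] 0) (𝓝 c)) (hg0 : Tendsto g (𝓝[>] 0) (𝓝 c)) :
    EqOn f g (Ioo 0 1) := by
  have hd : ∀ t ∈ Ioo (0 : ℝ) 1, HasDerivAt (f - g) 0 t := fun t ht => by
    simpa using (hf t ht).sub (hg t ht)
  obtain ⟨a, ha⟩ := isOpen_Ioo.exists_is_const_of_deriv_eq_zero isPreconnected_Ioo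
    (fun t ht => (hd t ht).differentiableAt.differentiableWithinAt) fun t ht => (hd t ht).deriv
  have h1 : Tendsto (f - g) (𝓝[>] 0) (𝓝 a) := by
    refine tendsto_const_nhds.congr' ?_
    filter_upwards [Ioo_mem_nhdsGT (zero_lt_one (α := ℝ))] with t ht using (ha t ht).symm
  have h2 : a = 0 := by
    refine tendsto_nhds_unique h1 ?_
    have h3 := hf0.sub hg0
    rwa [sub_self] at h3
  intro t ht
  have h4 := ha t ht
  rw [h2] at h4
  exact sub_eq_zero.1 h4

theorem tendsto_zero_of_mem_polylogSpan {N w : ℕ} (hN : N ≠ 0) {f : ℝ → ℂ}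
    (hf : f ∈ polylogSpan (coloredIndices N (w + 1))) : Tendsto f (𝓝[>] 0) (𝓝 0) := by
  induction hf using Submodule.span_induction with
  | mem f hf =>
    rcases hf with ⟨s, hs, rfl⟩ | hf
    · exact tendsto_polylog_zero hN hs
    · refine tendsto_const_nhds.congr' ?_
      filter_upwards [Ioo_mem_nhdsGT (zero_lt_one (α := ℝ))] with t ht using (hf ht).symm
  | zero => exact tendsto_const_nhds
  | add f g _ _ hf hg =>
    have h := hf.add hg
    rwa [add_zero] at h
  | smul q f _ hf =>
    have h := hf.const_smul q
    rwa [smul_zero] at h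

/-- A function vanishing at `0` whose derivative has a primitive in a span of multiple
polylogarithms of positive weight lies in that span itself. -/
theorem mem_polylogSpan_of_hasDerivAt {N w : ℕ} (hN : N ≠ 0) {C : Set (List (ℕ × ℂ))}
    (hC : C ⊆ coloredIndices N (w + 1)) {f φ : ℝ → ℂ}
    (hf : ∀ t ∈ Ioo (0 : ℝ) 1, HasDerivAt f (φ t) t) (hφ : φ ∈ primitivesIn (polylogSpan C))
    (hf0 : Tendsto f (𝓝[>] 0) (𝓝 0)) : f ∈ polylogSpan C := by
  obtain ⟨g, hg, hg'⟩ := hφ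
  exact polylogSpan_congr hg (eqOn_of_hasDerivAt hf hg' hf0
    (tendsto_zero_of_mem_polylogSpan hN (polylogSpan_mono hC hg)))

/-- The value at `1` of a combination of convergent multiple polylogarithms is a combination of
colored multiple zeta values. -/
theorem exists_tendsto_one_of_mem_polylogSpan {N w : ℕ} (hN : N ≠ 0) {f : ℝ → ℂ}
    (hf : f ∈ polylogSpan (convergentIndices N w)) :
    ∃ c ∈ CMZV N w, Tendsto f (𝓝[<] 1) (𝓝 c) := by
  induction hf using Submodule.span_induction with
  | mem f hf =>
    rcases hf with ⟨s, hs, rfl⟩ | hf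
    · obtain ⟨x, hx⟩ := exists_tendsto_truncatedLi hN hs
      exact ⟨x, Submodule.subset_span ⟨s, hs.1.1, hs.2, hs.1.2, hx⟩, tendsto_polylog_one hx⟩
    · refine ⟨0, zero_mem _, tendsto_const_nhds.congr' ?_⟩
      filter_upwards [Ioo_mem_nhdsLT (zero_lt_one (α := ℝ))] with t ht using (hf ht).symm
  | zero => exact ⟨0, zero_mem _, tendsto_const_nhds⟩
  | add f g _ _ hf hg =>
    obtain ⟨c, hc, hc'⟩ := hf
    obtain ⟨d, hd, hd'⟩ := hg
    exact ⟨c + d, add_mem hc hd, hc'.add hd'⟩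
  | smul q f _ hf =>
    obtain ⟨c, hc, hc'⟩ := hf
    exact ⟨q • c, Submodule.smul_mem _ q hc, hc'.const_smul q⟩

/-! ### The kernels of level four -/

theorem one_add_sq_ne_zero (t : ℝ) : (1 : ℂ) + (t : ℂ) ^ 2 ≠ 0 := by
  have h : (1 : ℝ) + t ^ 2 ≠ 0 := by positivity
  exact_mod_cast h

theorem kernel_I_eq (t : ℝ) :
    Complex.I / (1 - Complex.I * t) = (Complex.I - t) / (1 + (t : ℂ) ^ 2) := by
  have h : 1 + (t : ℂ) ^ 2 = (1 - Complex.I * t) * (1 + Complex.I * t) := by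
    linear_combination (t : ℂ) ^ 2 * Complex.I_sq
  have h0 := one_add_sq_ne_zero t
  rw [h] at h0 ⊢
  rw [div_eq_div_iff (left_ne_zero_of_mul h0) h0]
  linear_combination (t - t ^ 2 * Complex.I) * Complex.I_sq

theorem kernel_neg_I_eq (t : ℝ) :
    -Complex.I / (1 - -Complex.I * t) = (-Complex.I - t) / (1 + (t : ℂ) ^ 2) := by
  have h : 1 + (t : ℂ) ^ 2 = (1 - -Complex.I * t) * (1 - Complex.I * t) := by
    linear_combination (t : ℂ) ^ 2 * Complex.I_sq
  have h0 := one_add_sq_ne_zero t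
  rw [h] at h0 ⊢
  rw [div_eq_div_iff (left_ne_zero_of_mul h0) h0]
  linear_combination (t + t ^ 2 * Complex.I) * Complex.I_sq

theorem I_ne_one : Complex.I ≠ 1 := fun h => by simpa using congrArg Complex.im h

theorem neg_I_ne_one : -Complex.I ≠ 1 := fun h => by simpa using congrArg Complex.im h

theorem neg_I_pow_four : (-Complex.I) ^ 4 = 1 := by
  rw [Even.neg_pow (by decide), Complex.I_pow_four]

section Kernels

variable {w : ℕ} {f : ℝ → ℂ}

/-- Integration against `i · 2 dt / (1 + t²)`. -/
theorem arctan_kernel_mem (hf : f ∈ polylogSpan (coloredIndices 4 w)) :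
    (fun t : ℝ => Complex.I * (2 / (1 + (t : ℂ) ^ 2)) * f t) ∈
      primitivesIn (polylogSpan (convergentIndices 4 (w + 1))) := by
  refine primitivesIn_congr (sub_mem
    (kernel_mul_mem_primitivesIn_of_ne four_ne_zero Complex.I_pow_four I_ne_one hf)
    (kernel_mul_mem_primitivesIn_of_ne four_ne_zero neg_I_pow_four neg_I_ne_one hf))
    fun t _ => ?_
  simp only [Pi.sub_apply, kernel_I_eq, kernel_neg_I_eq]
  ring

/-- Integration against `2 t dt / (1 + t²)`. -/
theorem log_one_add_sq_kernel_mem (hf : f ∈ polylogSpan (coloredIndices 4 w)) :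
    (fun t : ℝ => 2 * t / (1 + (t : ℂ) ^ 2) * f t) ∈
      primitivesIn (polylogSpan (convergentIndices 4 (w + 1))) := by
  refine primitivesIn_congr (neg_mem (add_mem
    (kernel_mul_mem_primitivesIn_of_ne four_ne_zero Complex.I_pow_four I_ne_one hf)
    (kernel_mul_mem_primitivesIn_of_ne four_ne_zero neg_I_pow_four neg_I_ne_one hf)))
    fun t _ => ?_
  simp only [Pi.add_apply, Pi.neg_apply, kernel_I_eq, kernel_neg_I_eq]
  ring

/-- Integration against `2 t dt / (1 - t²)`. -/
theorem log_one_sub_sq_kernel_mem (hf : f ∈ polylogSpan (coloredIndices 4 w)) :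
    (fun t : ℝ => 2 * t / (1 - (t : ℂ) ^ 2) * f t) ∈
      primitivesIn (polylogSpan (coloredIndices 4 (w + 1))) := by
  refine primitivesIn_congr (add_mem
    (kernel_mul_mem_primitivesIn four_ne_zero (one_pow 4) hf)
    (kernel_mul_mem_primitivesIn four_ne_zero (σ := -1) (by norm_num) hf))
    fun t ht => ?_
  have ht' := abs_lt_one_of_mem_Ioo ht
  have h1 := one_sub_mul_ne_zero (σ := 1) (by simp) ht'
  have h2 := one_sub_mul_ne_zero (σ := -1) (by simp) ht'
  have h : 1 - (t : ℂ) ^ 2 = (1 - 1 * t) * (1 - -1 * t) := by ring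
  simp only [Pi.add_apply]
  rw [h, ← add_mul, div_add_div _ _ h1 h2]
  ring

/-- Integration against `dx / x = (1 - t²) dt / (t (1 + t²))`, where `x = 2 t / (1 + t²)`. -/
theorem log_kernel_mem (hf : f ∈ polylogSpan (coloredIndices 4 (w + 1))) :
    (fun t : ℝ => (1 - (t : ℂ) ^ 2) / (t * (1 + (t : ℂ) ^ 2)) * f t) ∈
      primitivesIn (polylogSpan (convergentIndices 4 (w + 2))) := by
  refine primitivesIn_congr (sub_mem (inv_mul_mem_primitivesIn four_ne_zero hf)
    (log_one_add_sq_kernel_mem hf)) fun t ht => ?_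
  have h0 : (t : ℂ) ≠ 0 := by exact_mod_cast ht.1.ne'
  have h1 := one_add_sq_ne_zero t
  simp only [Pi.sub_apply]
  field_simp
  ring

end Kernels

/-! ### Even power series and their differential equations -/

/-- The even power series `∑ u_n x ^ (2 n)`. -/
noncomputable def evenSeries (u : ℕ → ℝ) (x : ℝ) : ℝ := ∑' n, x ^ (2 * n) * u n

section EvenSeries

variable {u v h : ℕ → ℝ} {x : ℝ}

theorem PolyBounded.linear_mul (hu : PolyBounded u) (b : ℝ) :
    PolyBounded fun n : ℕ => (2 * (n : ℝ) + b) * u n :=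
  (polyBounded_linear b).mul hu

theorem PolyBounded.summable_evenSeries (hu : PolyBounded u) (hx : |x| < 1) :
    Summable fun n => x ^ (2 * n) * u n :=
  hu.summable_pow_smul (fun n => by lia) hx

theorem evenSeries_add (hu : PolyBounded u) (hv : PolyBounded v) (hx : |x| < 1) :
    evenSeries (fun n => u n + v n) x = evenSeries u x + evenSeries v x := by
  simp only [evenSeries, mul_add]
  exact (hu.summable_evenSeries hx).tsum_add (hv.summable_evenSeries hx)

theorem evenSeries_eq_add (hu : PolyBounded u) (hx : |x| < 1) :
    evenSeries u x = u 0 + x ^ 2 * evenSeries (fun n => u (n + 1)) x := by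
  rw [evenSeries, (hu.summable_evenSeries hx).tsum_eq_zero_add, evenSeries, ← tsum_mul_left]
  congr 1
  · simp
  · exact tsum_congr fun n => by ring

theorem evenSeries_zero_right (hu : PolyBounded u) : evenSeries u 0 = u 0 := by
  rw [evenSeries_eq_add hu (by simp)]
  ring

theorem hasDerivAt_mul_evenSeries (hu : PolyBounded u) (hx : |x| < 1) :
    HasDerivAt (fun y => y * evenSeries u y)
      (evenSeries (fun n => (2 * (n : ℝ) + 1) * u n) x) x := by
  have h := hu.hasDerivAt_tsum_pow_smul (e := fun n => 2 * n) (fun n => by lia)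
    (fun n => by lia) hx
  have hf : (fun y => y * evenSeries u y) = fun y : ℝ => ∑' n, y ^ (2 * n + 1) • u n := by
    ext y
    rw [evenSeries, ← tsum_mul_left]
    exact tsum_congr fun n => by rw [smul_eq_mul]; ring
  rw [hf]
  refine h.congr_deriv (tsum_congr fun n => ?_)
  rw [smul_eq_mul]
  push_cast
  ring

theorem hasDerivAt_sq_mul_evenSeries (hu : PolyBounded u) (hx : |x| < 1) :
    HasDerivAt (fun y => y ^ 2 * evenSeries u y)
      (x * evenSeries (fun n => (2 * (n : ℝ) + 2) * u n) x) x := by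
  have h := hu.hasDerivAt_tsum_pow_smul (e := fun n => 2 * n + 1) (fun n => by lia)
    (fun n => by lia) hx
  have hf : (fun y => y ^ 2 * evenSeries u y) =
      fun y : ℝ => ∑' n, y ^ (2 * n + 1 + 1) • u n := by
    ext y
    rw [evenSeries, ← tsum_mul_left]
    exact tsum_congr fun n => by rw [smul_eq_mul]; ring
  rw [hf]
  refine h.congr_deriv ?_
  rw [evenSeries, ← tsum_mul_left]
  refine tsum_congr fun n => ?_
  rw [smul_eq_mul]
  push_cast
  ring

theorem hasDerivAt_evenSeries (hu : PolyBounded u) (hx : |x| < 1) :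
    HasDerivAt (evenSeries u) (x * evenSeries (fun n => (2 * (n : ℝ) + 2) * u (n + 1)) x) x := by
  have h := (hasDerivAt_sq_mul_evenSeries hu.comp_succ hx).const_add (u 0)
  refine h.congr_of_eventuallyEq ?_
  filter_upwards [(isOpen_lt continuous_abs continuous_const).mem_nhds hx] with y hy
  exact evenSeries_eq_add hu hy

theorem one_sub_sq_ne_zero (hx : |x| < 1) : 1 - x ^ 2 ≠ 0 := by
  have := (sq_lt_one_iff_abs_lt_one x).2 hx
  linarith

/-- A recurrence of the coefficients of an even power series `G` as a differential equation
`(1 - x²) G' = x G + x H`. -/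
theorem hasDerivAt_evenSeries_of_rec (hu : PolyBounded u) (hh : PolyBounded h)
    (hrec : ∀ n : ℕ, (2 * (n : ℝ) + 2) * u (n + 1) = (2 * (n : ℝ) + 1) * u n + h n)
    (hx : |x| < 1) :
    HasDerivAt (evenSeries u) (x * (evenSeries u x + evenSeries h x) / (1 - x ^ 2)) x := by
  have h1 := hasDerivAt_evenSeries hu hx
  refine h1.congr_deriv ?_
  rw [eq_div_iff (one_sub_sq_ne_zero hx)]
  have h2 := (hasDerivAt_id x).mul h1
  have h3 := (hasDerivAt_mul_evenSeries hu hx).unique h2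
  simp only [id_eq, one_mul] at h3
  simp_rw [hrec] at h3 ⊢
  rw [evenSeries_add (hu.linear_mul 1) hh hx] at h3 ⊢
  linear_combination x * h3

/-- A recurrence of the coefficients of an odd power series `P` as a differential equation
`(1 - x²) P' = x P + H`. -/
theorem hasDerivAt_mul_evenSeries_of_rec (hu : PolyBounded u) (hh : PolyBounded h)
    (h0 : u 0 = h 0)
    (hrec : ∀ n : ℕ, (2 * (n : ℝ) + 3) * u (n + 1) = (2 * (n : ℝ) + 2) * u n + h (n + 1))
    (hx : |x| < 1) :
    HasDerivAt (fun y => y * evenSeries u y)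
      ((x * (x * evenSeries u x) + evenSeries h x) / (1 - x ^ 2)) x := by
  refine (hasDerivAt_mul_evenSeries hu hx).congr_deriv ?_
  rw [eq_div_iff (one_sub_sq_ne_zero hx)]
  have h1 : evenSeries (fun n => (2 * (n : ℝ) + 1) * u n) x = u 0 +
      x ^ 2 * (evenSeries (fun n => (2 * (n : ℝ) + 2) * u n) x +
        evenSeries (fun n => h (n + 1)) x) := by
    rw [evenSeries_eq_add (hu.linear_mul 1) hx,
      ← evenSeries_add (hu.linear_mul 2) hh.comp_succ hx]
    congr 1
    · simp
    · congr 2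
      ext n
      rw [← hrec]
      push_cast
      ring
  have h2 : evenSeries (fun n => (2 * (n : ℝ) + 2) * u n) x =
      evenSeries (fun n => (2 * (n : ℝ) + 1) * u n) x + evenSeries u x := by
    rw [← evenSeries_add (hu.linear_mul 1) hu hx]
    congr 1
    ext n
    ring
  have h3 := evenSeries_eq_add hh hx
  rw [h2] at h1
  linear_combination h1 - h3 + h0

/-! ### The substitution `x = 2 t / (1 + t²)` -/

/-- The rational substitution `x = 2 t / (1 + t²)`, that is, `sin θ` for `t = tan (θ / 2)`. -/
noncomputable def sinSubst (t : ℝ) : ℝ := 2 * t / (1 + t ^ 2)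

/-- `√(1 - x²) = (1 - t²) / (1 + t²)` in terms of `x = sinSubst t`. -/
noncomputable def cosSubst (t : ℝ) : ℝ := (1 - t ^ 2) / (1 + t ^ 2)

variable {t : ℝ}

theorem cosSubst_sq (t : ℝ) : cosSubst t ^ 2 = 1 - sinSubst t ^ 2 := by
  have : 1 + t ^ 2 ≠ 0 := by positivity
  rw [cosSubst, sinSubst]
  field_simp
  ring

theorem cosSubst_pos (ht : |t| < 1) : 0 < cosSubst t := by
  have := (sq_lt_one_iff_abs_lt_one t).2 ht
  exact div_pos (by linarith) (by positivity)

theorem abs_sinSubst_lt_one (ht : |t| < 1) : |sinSubst t| < 1 := by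
  rw [← sq_lt_one_iff_abs_lt_one]
  have := cosSubst_sq t
  have := pow_pos (cosSubst_pos ht) 2
  linarith

theorem sinSubst_zero : sinSubst 0 = 0 := by simp [sinSubst]

theorem sinSubst_one : sinSubst 1 = 1 := by norm_num [sinSubst]

theorem sinSubst_eq (t : ℝ) : sinSubst t = t * (2 / (1 + t ^ 2)) := by
  rw [sinSubst]
  ring

theorem sinSubst_pos (ht : 0 < t) : 0 < sinSubst t := div_pos (by linarith) (by positivity)

theorem hasDerivAt_sinSubst (t : ℝ) :
    HasDerivAt sinSubst (cosSubst t * (2 / (1 + t ^ 2))) t := by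
  have h0 : 1 + t ^ 2 ≠ 0 := by positivity
  have h := ((hasDerivAt_id t).const_mul 2).div ((hasDerivAt_pow 2 t).const_add 1) h0
  refine h.congr_deriv ?_
  rw [cosSubst]
  simp only [id_eq]
  field_simp
  push_cast
  ring

theorem hasDerivAt_cosSubst (t : ℝ) :
    HasDerivAt cosSubst (-(sinSubst t * (2 / (1 + t ^ 2)))) t := by
  have h0 : 1 + t ^ 2 ≠ 0 := by positivity
  have h := ((hasDerivAt_pow 2 t).const_sub 1).div ((hasDerivAt_pow 2 t).const_add 1) h0
  refine h.congr_deriv ?_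
  rw [sinSubst]
  field_simp
  push_cast
  ring

/-- The factor `√(1 - x²)` integrates the equation `(1 - x²) G' = x G + x H`. -/
theorem hasDerivAt_cosSubst_mul_evenSeries (hu : PolyBounded u) (hh : PolyBounded h)
    (hrec : ∀ n : ℕ, (2 * (n : ℝ) + 2) * u (n + 1) = (2 * (n : ℝ) + 1) * u n + h n)
    (ht : |t| < 1) :
    HasDerivAt (fun t => cosSubst t * evenSeries u (sinSubst t))
      (2 / (1 + t ^ 2) * (sinSubst t * evenSeries h (sinSubst t))) t := by
  have h1 := (hasDerivAt_evenSeries_of_rec hu hh hrec (abs_sinSubst_lt_one ht)).comp t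
    (hasDerivAt_sinSubst t)
  refine ((hasDerivAt_cosSubst t).mul h1).congr_deriv ?_
  have hy := (cosSubst_pos ht).ne'
  rw [← cosSubst_sq, Function.comp]
  field_simp
  ring

/-- The factor `√(1 - x²)` integrates the equation `(1 - x²) P' = x P + H`. -/
theorem hasDerivAt_cosSubst_mul_sinSubst_mul_evenSeries (hu : PolyBounded u)
    (hh : PolyBounded h) (h0 : u 0 = h 0)
    (hrec : ∀ n : ℕ, (2 * (n : ℝ) + 3) * u (n + 1) = (2 * (n : ℝ) + 2) * u n + h (n + 1))
    (ht : |t| < 1) :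
    HasDerivAt (fun t => cosSubst t * (sinSubst t * evenSeries u (sinSubst t)))
      (2 / (1 + t ^ 2) * evenSeries h (sinSubst t)) t := by
  have h1 := (hasDerivAt_mul_evenSeries_of_rec hu hh h0 hrec (abs_sinSubst_lt_one ht)).comp t
    (hasDerivAt_sinSubst t)
  refine ((hasDerivAt_cosSubst t).mul h1).congr_deriv ?_
  have hy := (cosSubst_pos ht).ne'
  rw [← cosSubst_sq, Function.comp]
  field_simp
  ring

theorem hasDerivAt_sinSubst_mul_evenSeries (hv : PolyBounded v)
    (huv : ∀ n : ℕ, (2 * (n : ℝ) + 1) * v n = u n) (ht : |t| < 1) :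
    HasDerivAt (fun t => sinSubst t * evenSeries v (sinSubst t))
      (evenSeries u (sinSubst t) * (cosSubst t * (2 / (1 + t ^ 2)))) t := by
  have h1 := (hasDerivAt_mul_evenSeries hv (abs_sinSubst_lt_one ht)).comp t
    (hasDerivAt_sinSubst t)
  simp_rw [huv] at h1
  exact h1

theorem hasDerivAt_sinSubst_sq_mul_evenSeries (hv : PolyBounded v)
    (huv : ∀ n : ℕ, (2 * (n : ℝ) + 2) * v n = u n) (ht : |t| < 1) :
    HasDerivAt (fun t => sinSubst t ^ 2 * evenSeries v (sinSubst t))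
      (sinSubst t * evenSeries u (sinSubst t) * (cosSubst t * (2 / (1 + t ^ 2)))) t := by
  have h1 := (hasDerivAt_sq_mul_evenSeries hv (abs_sinSubst_lt_one ht)).comp t
    (hasDerivAt_sinSubst t)
  simp_rw [huv] at h1
  exact h1

theorem tendsto_sinSubst_one : Tendsto sinSubst (𝓝[<] 1) (𝓝 1) := by
  have h := (hasDerivAt_sinSubst 1).continuousAt.tendsto
  rw [sinSubst_one] at h
  exact h.mono_left nhdsWithin_le_nhds

/-- A power series with nonnegative coefficients that has a limit at `1` converges there. -/
theorem hasSum_of_tendsto_evenSeries (hu : PolyBounded u) (h0 : ∀ n, 0 ≤ u n) {l : ℝ}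
    (hl : Tendsto (fun t => evenSeries u (sinSubst t)) (𝓝[<] 1) (𝓝 l)) : HasSum u l := by
  have hmem : ∀ᶠ t in 𝓝[<] (1 : ℝ), t ∈ Ioo (0 : ℝ) 1 := Ioo_mem_nhdsLT zero_lt_one
  have hterm : ∀ n, Tendsto (fun t => sinSubst t ^ (2 * n) * u n) (𝓝[<] 1) (𝓝 (u n)) := by
    intro n
    simpa using (tendsto_sinSubst_one.pow (2 * n)).mul_const (u n)
  have hsum : Summable u := by
    refine summable_of_sum_le h0 (c := l) fun s => ?_
    refine le_of_tendsto_of_tendsto (tendsto_finsetSum s fun n _ => hterm n) hl ?_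
    filter_upwards [hmem] with t ht
    exact (hu.summable_evenSeries (abs_sinSubst_lt_one (abs_lt_one_of_mem_Ioo ht))).sum_le_tsum s
      fun n _ => mul_nonneg (pow_nonneg (sinSubst_pos ht.1).le _) (h0 n)
  have hlim : Tendsto (fun t => evenSeries u (sinSubst t)) (𝓝[<] 1) (𝓝 (∑' n, u n)) := by
    refine tendsto_tsum_of_dominated_convergence hsum hterm ?_
    filter_upwards [hmem] with t ht n
    have hx := abs_sinSubst_lt_one (abs_lt_one_of_mem_Ioo ht)
    rw [norm_mul, norm_pow, Real.norm_eq_abs, Real.norm_of_nonneg (h0 n)]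
    exact mul_le_of_le_one_left (h0 n) (pow_le_one₀ (abs_nonneg _) hx.le)
  rw [tendsto_nhds_unique hl hlim]
  exact hsum.hasSum

/-- The limit at `1` of an integrated power series with nonnegative coefficients is its sum. -/
theorem hasSum_of_tendsto_pow_mul_evenSeries (hu : PolyBounded u) (h0 : ∀ n, 0 ≤ u n) (p : ℕ)
    {c : ℂ} (hc : Tendsto
      (fun t => ((sinSubst t ^ p * evenSeries u (sinSubst t) : ℝ) : ℂ)) (𝓝[<] 1) (𝓝 c)) :
    HasSum (fun n => (u n : ℂ)) c := by
  have h1 : Tendsto (fun t => sinSubst t ^ p * evenSeries u (sinSubst t)) (𝓝[<] 1) (𝓝 c.re) :=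
    (Complex.continuous_re.tendsto c).comp hc
  have hre : (c.re : ℂ) = c :=
    tendsto_nhds_unique ((Complex.continuous_ofReal.tendsto _).comp h1) hc
  have h2 : Tendsto (fun t => evenSeries u (sinSubst t)) (𝓝[<] 1) (𝓝 c.re) := by
    have h3 := h1.div (tendsto_sinSubst_one.pow p) (by simp)
    rw [one_pow, div_one] at h3
    refine h3.congr' ?_
    filter_upwards [Ioo_mem_nhdsLT (zero_lt_one (α := ℝ))] with t ht
    exact mul_div_cancel_left₀ _ (pow_pos (sinSubst_pos ht.1) p).ne'
  rw [← hre]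
  exact Complex.hasSum_ofReal.2 (hasSum_of_tendsto_evenSeries hu h0 h2)

end EvenSeries

/-! ### The coefficient sequences -/

theorem polyBounded_multipleTSum (k : List ℕ) : PolyBounded (multipleTSum k) := by
  refine ⟨1, k.length, fun n => ?_⟩
  induction k generalizing n with
  | nil => simp [multipleTSum]
  | cons j k ih =>
    simp only [multipleTSum, List.length_cons, one_mul] at ih ⊢
    calc ‖∑ a ∈ Finset.range n, 1 / (2 * (a : ℝ) + 1) ^ j * multipleTSum k a‖
        ≤ ∑ a ∈ Finset.range n, ((n : ℝ) + 1) ^ k.length := by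
          refine norm_sum_le_of_le _ fun a ha => ?_
          have ha' : (a : ℝ) ≤ n := by exact_mod_cast (Finset.mem_range.1 ha).le
          have h1 : (1 : ℝ) ≤ (2 * (a : ℝ) + 1) ^ j := one_le_pow₀ (by
            linarith [a.cast_nonneg (α := ℝ)])
          rw [norm_mul, Real.norm_of_nonneg (by positivity)]
          calc 1 / (2 * (a : ℝ) + 1) ^ j * ‖multipleTSum k a‖ ≤ 1 * ((a : ℝ) + 1) ^ k.length := by
                gcongr
                · exact (div_le_one (by positivity)).2 h1
                · exact ih a
            _ ≤ _ := by
                rw [one_mul]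
                gcongr
      _ = n * ((n : ℝ) + 1) ^ k.length := by simp
      _ ≤ _ := by
        rw [pow_succ, mul_comm]
        gcongr
        linarith

theorem multipleTSum_nonneg (k : List ℕ) (n : ℕ) : 0 ≤ multipleTSum k n := by
  induction k generalizing n with
  | nil => simp [multipleTSum]
  | cons j k ih => exact Finset.sum_nonneg fun a _ => mul_nonneg (by positivity) (ih a)

theorem multipleTSum_cons_succ (j : ℕ) (k : List ℕ) (n : ℕ) :
    multipleTSum (j :: k) (n + 1) =
      multipleTSum (j :: k) n + 1 / (2 * (n : ℝ) + 1) ^ j * multipleTSum k n := by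
  simp [multipleTSum, Finset.sum_range_succ]

theorem multipleTSum_cons_zero (j : ℕ) (k : List ℕ) : multipleTSum (j :: k) 0 = 0 := by
  simp [multipleTSum]

/-- The coefficients `binom(2n, n) / 4 ^ n` of `1 / √(1 - x²)`. -/
noncomputable def arcsinCoeff (n : ℕ) : ℝ := n.centralBinom / 4 ^ n

/-- The coefficients `4 ^ (n + 1) / ((2 n + 2) binom(2n + 2, n + 1))` of
`arcsin x / √(1 - x²)`. -/
noncomputable def arcsinSqCoeff (n : ℕ) : ℝ :=
  4 ^ (n + 1) / (n + 1).centralBinom / (2 * (n : ℝ) + 2)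

theorem centralBinom_rec (n : ℕ) :
    ((n : ℝ) + 1) * (n + 1).centralBinom = 2 * (2 * (n : ℝ) + 1) * n.centralBinom := by
  exact_mod_cast Nat.succ_mul_centralBinom_succ n

theorem arcsinCoeff_rec (n : ℕ) :
    (2 * (n : ℝ) + 2) * arcsinCoeff (n + 1) = (2 * (n : ℝ) + 1) * arcsinCoeff n := by
  have h := centralBinom_rec n
  rw [arcsinCoeff, arcsinCoeff, pow_succ]
  field_simp
  linear_combination 2 * h

theorem arcsinSqCoeff_rec (n : ℕ) :
    (2 * (n : ℝ) + 3) * arcsinSqCoeff (n + 1) = (2 * (n : ℝ) + 2) * arcsinSqCoeff n := by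
  have h := centralBinom_rec (n + 1)
  have h1 : ((n + 1).centralBinom : ℝ) ≠ 0 := by
    exact_mod_cast Nat.centralBinom_ne_zero (n + 1)
  have h2 : ((n + 1 + 1).centralBinom : ℝ) ≠ 0 := by
    exact_mod_cast Nat.centralBinom_ne_zero (n + 1 + 1)
  rw [arcsinSqCoeff, arcsinSqCoeff, pow_succ _ (n + 1)]
  push_cast at h ⊢
  have h3 : 2 * ((n : ℝ) + 1) + 2 ≠ 0 := by positivity
  field_simp
  linear_combination -2 * h

theorem arcsinCoeff_nonneg (n : ℕ) : 0 ≤ arcsinCoeff n := by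
  unfold arcsinCoeff
  positivity

theorem arcsinSqCoeff_nonneg (n : ℕ) : 0 ≤ arcsinSqCoeff n := by
  unfold arcsinSqCoeff
  positivity

theorem arcsinSqCoeff_zero : arcsinSqCoeff 0 = 1 := by
  norm_num [arcsinSqCoeff, Nat.centralBinom, Nat.choose]

theorem polyBounded_arcsinCoeff : PolyBounded arcsinCoeff := by
  refine ⟨1, 0, fun n => ?_⟩
  rw [Real.norm_of_nonneg (arcsinCoeff_nonneg n), pow_zero, one_mul]
  induction n with
  | zero => simp [arcsinCoeff]
  | succ n ih => nlinarith [arcsinCoeff_rec n, arcsinCoeff_nonneg n, n.cast_nonneg (α := ℝ)]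

theorem polyBounded_arcsinSqCoeff : PolyBounded arcsinSqCoeff := by
  refine ⟨1, 0, fun n => ?_⟩
  rw [Real.norm_of_nonneg (arcsinSqCoeff_nonneg n), pow_zero, one_mul]
  induction n with
  | zero => exact arcsinSqCoeff_zero.le
  | succ n ih =>
    nlinarith [arcsinSqCoeff_rec n, arcsinSqCoeff_nonneg n, n.cast_nonneg (α := ℝ)]

theorem PolyBounded.div_pow {u : ℕ → ℝ} (hu : PolyBounded u) {b : ℝ} (hb : 1 ≤ b) (m : ℕ) :
    PolyBounded fun n : ℕ => u n / (2 * (n : ℝ) + b) ^ m := by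
  refine hu.mono fun n => ?_
  have h : (1 : ℝ) ≤ (2 * (n : ℝ) + b) ^ m :=
    one_le_pow₀ (by linarith [n.cast_nonneg (α := ℝ)])
  rw [norm_div, Real.norm_of_nonneg (zero_le_one.trans h)]
  exact div_le_self (norm_nonneg _) h

/-- The terms `binom(2n, n) / 4 ^ n * t_n(k) / (2 n + 1) ^ m` of the first series. -/
noncomputable def seqA (k : List ℕ) (m n : ℕ) : ℝ :=
  arcsinCoeff n * multipleTSum k n / (2 * (n : ℝ) + 1) ^ m

/-- The analogue of `seqA` for the reciprocal binomial coefficients. -/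
noncomputable def seqQ (k : List ℕ) (m n : ℕ) : ℝ :=
  arcsinSqCoeff n * multipleTSum k n / (2 * (n : ℝ) + 1) ^ m

/-- The terms of the second series, up to the factor `2 ^ (m + 1)`. In contrast to `seqQ`, the
harmonic sum extends to the index `n + 1`. -/
noncomputable def seqW (k : List ℕ) (m n : ℕ) : ℝ :=
  arcsinSqCoeff n * multipleTSum k (n + 1) / (2 * (n : ℝ) + 2) ^ m

/-- The difference of `seqW k 0` and `seqQ k 0`. -/
noncomputable def seqD (k : List ℕ) (n : ℕ) : ℝ :=
  arcsinSqCoeff n * (multipleTSum k (n + 1) - multipleTSum k n)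

theorem polyBounded_seqA (k : List ℕ) (m : ℕ) : PolyBounded (seqA k m) :=
  (polyBounded_arcsinCoeff.mul (polyBounded_multipleTSum k)).div_pow le_rfl m

theorem polyBounded_seqQ (k : List ℕ) (m : ℕ) : PolyBounded (seqQ k m) :=
  (polyBounded_arcsinSqCoeff.mul (polyBounded_multipleTSum k)).div_pow le_rfl m

theorem polyBounded_seqW (k : List ℕ) (m : ℕ) : PolyBounded (seqW k m) :=
  (polyBounded_arcsinSqCoeff.mul (polyBounded_multipleTSum k).comp_succ).div_pow one_le_two m

theorem seqD_nil : seqD [] = 0 := by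
  ext n
  simp [seqD, multipleTSum]

theorem seqD_cons (j : ℕ) (k : List ℕ) : seqD (j :: k) = seqQ k j := by
  ext n
  rw [seqD, seqQ, multipleTSum_cons_succ]
  ring

theorem polyBounded_seqD (k : List ℕ) : PolyBounded (seqD k) := by
  cases k with
  | nil =>
    rw [seqD_nil]
    exact polyBounded_const (0 : ℝ)
  | cons j k =>
    rw [seqD_cons]
    exact polyBounded_seqQ k j

theorem seqW_zero_eq (k : List ℕ) (n : ℕ) : seqW k 0 n = seqQ k 0 n + seqD k n := by
  simp only [seqW, seqQ, seqD, pow_zero, div_one]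
  ring

theorem mul_seqA_succ (k : List ℕ) (m n : ℕ) :
    (2 * (n : ℝ) + 1) * seqA k (m + 1) n = seqA k m n := by
  have : 2 * (n : ℝ) + 1 ≠ 0 := by positivity
  rw [seqA, seqA, pow_succ]
  field_simp

theorem mul_seqQ_succ (k : List ℕ) (m n : ℕ) :
    (2 * (n : ℝ) + 1) * seqQ k (m + 1) n = seqQ k m n := by
  have : 2 * (n : ℝ) + 1 ≠ 0 := by positivity
  rw [seqQ, seqQ, pow_succ]
  field_simp

theorem mul_seqW_succ (k : List ℕ) (m n : ℕ) :
    (2 * (n : ℝ) + 2) * seqW k (m + 1) n = seqW k m n := by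
  have : 2 * (n : ℝ) + 2 ≠ 0 := by positivity
  rw [seqW, seqW, pow_succ]
  field_simp

theorem seqA_nil_rec (n : ℕ) :
    (2 * (n : ℝ) + 2) * seqA [] 0 (n + 1) = (2 * (n : ℝ) + 1) * seqA [] 0 n + 0 := by
  simp only [seqA, multipleTSum, pow_zero, div_one, mul_one, add_zero]
  exact arcsinCoeff_rec n

theorem seqA_cons_rec (j : ℕ) (k : List ℕ) (n : ℕ) :
    (2 * (n : ℝ) + 2) * seqA ((j + 1) :: k) 0 (n + 1) =
      (2 * (n : ℝ) + 1) * seqA ((j + 1) :: k) 0 n + seqA k j n := by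
  have h0 : 2 * (n : ℝ) + 1 ≠ 0 := by positivity
  have h := arcsinCoeff_rec n
  simp only [seqA, pow_zero, div_one]
  rw [multipleTSum_cons_succ, ← mul_assoc, h, pow_succ]
  field_simp

theorem seqW_nil_rec (n : ℕ) :
    (2 * (n : ℝ) + 3) * seqW [] 0 (n + 1) =
      (2 * (n : ℝ) + 2) * seqW [] 0 n + (Pi.single 0 1 : ℕ → ℝ) (n + 1) := by
  rw [Pi.single_eq_of_ne n.succ_ne_zero]
  simp only [seqW, multipleTSum, pow_zero, div_one, mul_one, add_zero]
  exact arcsinSqCoeff_rec n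

theorem seqW_cons_rec (j : ℕ) (k : List ℕ) (n : ℕ) :
    (2 * (n : ℝ) + 3) * seqW ((j + 1) :: k) 0 (n + 1) =
      (2 * (n : ℝ) + 2) * seqW ((j + 1) :: k) 0 n + seqQ k j (n + 1) := by
  have h0 : 2 * ((n : ℝ) + 1) + 1 ≠ 0 := by positivity
  have h := arcsinSqCoeff_rec n
  simp only [seqW, seqQ, pow_zero, div_one]
  rw [multipleTSum_cons_succ _ _ (n + 1), pow_succ]
  push_cast
  field_simp
  linear_combination multipleTSum ((j + 1) :: k) (n + 1) * (2 * ((n : ℝ) + 1) + 1) ^ (j + 1) * h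

theorem seqW_cons_zero (i j : ℕ) (k : List ℕ) : seqW (i :: k) 0 0 = seqQ k j 0 := by
  simp [seqW, seqQ, multipleTSum_cons_succ, multipleTSum_cons_zero]

/-! ### The generating functions as multiple polylogarithms -/

/-- A real function vanishing at `0` is, up to the constant factor `c`, a combination of multiple
polylogarithms as soon as its derivative has such a primitive. -/
theorem ofReal_mem_polylogSpan {w : ℕ} {C : Set (List (ℕ × ℂ))} (hC : C ⊆ coloredIndices 4 (w + 1))
    (c : ℂ) {F φ : ℝ → ℝ} (hF : ∀ t : ℝ, |t| < 1 → HasDerivAt F (φ t) t) (h0 : F 0 = 0)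
    {ψ : ℝ → ℂ} (hψ : ψ ∈ primitivesIn (polylogSpan C))
    (hφ : ∀ t ∈ Ioo (0 : ℝ) 1, c * (φ t : ℂ) = ψ t) :
    (fun t => c * (F t : ℂ)) ∈ polylogSpan C := by
  refine mem_polylogSpan_of_hasDerivAt four_ne_zero hC (φ := ψ) (fun t ht => ?_) hψ ?_
  · rw [← hφ t ht]
    exact (hF t (abs_lt_one_of_mem_Ioo ht)).ofReal_comp.const_mul c
  · have h := ((hF 0 (by simp)).ofReal_comp.const_mul c).continuousAt.tendsto
    simp only [h0, Complex.ofReal_zero, mul_zero] at h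
    exact h.mono_left nhdsWithin_le_nhds

/-- `√(1 - x²) ∑ binom(2n, n) / 4 ^ n t_n(k) x ^ (2 n)` at `x = 2 t / (1 + t²)`. -/
noncomputable def funA (k : List ℕ) (t : ℝ) : ℝ :=
  cosSubst t * evenSeries (seqA k 0) (sinSubst t)

/-- The generating function of the first series at `x = 2 t / (1 + t²)`. -/
noncomputable def funB (k : List ℕ) (m : ℕ) (t : ℝ) : ℝ :=
  sinSubst t * evenSeries (seqA k m) (sinSubst t)

/-- The odd generating function of `seqW k 0`, times `√(1 - x²)`, at `x = 2 t / (1 + t²)`. -/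
noncomputable def funP (k : List ℕ) (t : ℝ) : ℝ :=
  cosSubst t * (sinSubst t * evenSeries (seqW k 0) (sinSubst t))

/-- The odd generating function of `seqQ k m` at `x = 2 t / (1 + t²)`. -/
noncomputable def funQ (k : List ℕ) (m : ℕ) (t : ℝ) : ℝ :=
  sinSubst t * evenSeries (seqQ k m) (sinSubst t)

/-- The odd generating function of `seqD k` at `x = 2 t / (1 + t²)`. -/
noncomputable def funD (k : List ℕ) (t : ℝ) : ℝ :=
  sinSubst t * evenSeries (seqD k) (sinSubst t)

/-- The generating function of the second series, up to a constant, at `x = 2 t / (1 + t²)`. -/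
noncomputable def funW (k : List ℕ) (m : ℕ) (t : ℝ) : ℝ :=
  sinSubst t ^ 2 * evenSeries (seqW k m) (sinSubst t)

theorem ofReal_one_sub_sq_ne_zero {t : ℝ} (ht : |t| < 1) : (1 : ℂ) - (t : ℂ) ^ 2 ≠ 0 := by
  exact_mod_cast one_sub_sq_ne_zero ht

theorem ofReal_ne_zero_of_mem_Ioo {t : ℝ} (ht : t ∈ Ioo (0 : ℝ) 1) : (t : ℂ) ≠ 0 := by
  exact_mod_cast ht.1.ne'

/-- The generating function of the first series arises from `funA k` by one integration against
`dx / √(1 - x²)` and `m` integrations against `dx / x`. -/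
theorem funB_mem {k : List ℕ}
    (hA : (fun t => (funA k t : ℂ)) ∈ polylogSpan (coloredIndices 4 k.sum)) (m : ℕ) :
    (fun t => Complex.I * (funB k (m + 1) t : ℂ)) ∈
      polylogSpan (convergentIndices 4 (k.sum + m + 1)) := by
  induction m with
  | zero =>
    refine ofReal_mem_polylogSpan (convergentIndices_subset _ _) Complex.I
      (fun t ht => hasDerivAt_sinSubst_mul_evenSeries (polyBounded_seqA k 1)
        (mul_seqA_succ k 0) ht) (by simp [funB, sinSubst_zero]) (arctan_kernel_mem hA)
      fun t ht => ?_
    simp only [funA]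
    push_cast
    ring
  | succ m ih =>
    refine ofReal_mem_polylogSpan (convergentIndices_subset _ _) Complex.I
      (fun t ht => hasDerivAt_sinSubst_mul_evenSeries (polyBounded_seqA k (m + 2))
        (mul_seqA_succ k (m + 1)) ht) (by simp [funB, sinSubst_zero])
      (log_kernel_mem (polylogSpan_mono (convergentIndices_subset _ _) ih)) fun t ht => ?_
    have h0 := ofReal_ne_zero_of_mem_Ioo ht
    have h1 := one_add_sq_ne_zero t
    simp only [funB]
    rw [sinSubst_eq, cosSubst]
    push_cast
    field_simp

/-- The binomial series `∑ binom(2n, n) / 4 ^ n x ^ (2 n) = 1 / √(1 - x²)`. -/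
theorem funA_nil_eq {t : ℝ} (ht : t ∈ Ioo (0 : ℝ) 1) : (funA [] t : ℂ) = 1 := by
  have hA : ∀ t : ℝ, |t| < 1 → HasDerivAt (funA []) 0 t := fun t ht => by
    have h := hasDerivAt_cosSubst_mul_evenSeries (polyBounded_seqA [] 0)
      (polyBounded_const (0 : ℝ)) seqA_nil_rec ht
    exact h.congr_deriv (by simp [evenSeries])
  have h0 : funA [] 0 = 1 := by
    simp [funA, cosSubst, sinSubst_zero, evenSeries_zero_right (polyBounded_seqA [] 0), seqA,
      arcsinCoeff, multipleTSum]
  refine eqOn_of_hasDerivAt (f := fun t => (funA [] t : ℂ)) (g := fun _ => 1) (φ := fun _ => 0)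
    (c := 1) (fun t ht => ?_) (fun t _ => hasDerivAt_const t 1) ?_ tendsto_const_nhds ht
  · simpa using (hA t (abs_lt_one_of_mem_Ioo ht)).ofReal_comp
  · have h := (hA 0 (by simp)).ofReal_comp.continuousAt.tendsto
    rw [h0, Complex.ofReal_one] at h
    exact h.mono_left nhdsWithin_le_nhds

/-- Removing the first entry `j` of `k` is an integration of `funB _ (j - 1)` against
`dx / √(1 - x²)`. For `j = 1` the factor `1 / √(1 - x²)` in `funB _ 0` is absorbed by the form, which
becomes `x dx / (1 - x²)`. -/
theorem funA_mem (k : List ℕ) (hk : ∀ a ∈ k, 0 < a) :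
    (fun t => (funA k t : ℂ)) ∈ polylogSpan (coloredIndices 4 k.sum) := by
  induction k with
  | nil =>
    refine polylogSpan_congr (f := polylog []) (Submodule.subset_span (Or.inl ⟨[], ?_, rfl⟩))
      fun t ht => funA_nil_eq ht
    exact ⟨by simp, rfl⟩
  | cons j k ih =>
    have hA := ih fun a ha => hk a (List.mem_cons_of_mem _ ha)
    obtain ⟨j, rfl⟩ : ∃ i, j = i + 1 := ⟨j - 1, by have := hk j (by simp); lia⟩
    have hd : ∀ t : ℝ, |t| < 1 → HasDerivAt (funA ((j + 1) :: k))
        (2 / (1 + t ^ 2) * funB k j t) t := fun t ht =>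
      hasDerivAt_cosSubst_mul_evenSeries (polyBounded_seqA _ 0) (polyBounded_seqA k j)
        (seqA_cons_rec j k) ht
    have h0 : funA ((j + 1) :: k) 0 = 0 := by
      simp [funA, sinSubst_zero, evenSeries_zero_right (polyBounded_seqA _ 0), seqA,
        multipleTSum_cons_zero]
    have hw : ((j + 1) :: k).sum = k.sum + j + 1 := by
      rw [List.sum_cons]
      ring
    rw [hw]
    suffices h : (fun t => (1 : ℂ) * (funA ((j + 1) :: k) t : ℂ)) ∈
        polylogSpan (coloredIndices 4 (k.sum + j + 1)) by simpa only [one_mul] using h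
    cases j with
    | zero =>
      -- Here `x dx / (1 - x²) = 2 t dt / (1 - t²) + 2 t dt / (1 + t²)`.
      refine ofReal_mem_polylogSpan subset_rfl 1 hd h0
        (add_mem (log_one_sub_sq_kernel_mem hA) (primitivesIn_mono
          (polylogSpan_mono (convergentIndices_subset _ _)) (log_one_add_sq_kernel_mem hA)))
        fun t ht => ?_
      have h1 := one_add_sq_ne_zero t
      have h2 := ofReal_one_sub_sq_ne_zero (abs_lt_one_of_mem_Ioo ht)
      simp only [Pi.add_apply, funA, funB]
      rw [sinSubst, cosSubst]
      push_cast
      field_simp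
      ring
    | succ j =>
      refine ofReal_mem_polylogSpan subset_rfl 1 hd h0
        (neg_mem (primitivesIn_mono (polylogSpan_mono (convergentIndices_subset _ _))
          (arctan_kernel_mem (polylogSpan_mono (convergentIndices_subset _ _) (funB_mem hA j)))))
        fun t _ => ?_
      simp only [Pi.neg_apply]
      push_cast
      linear_combination (2 / (1 + (t : ℂ) ^ 2) * funB k (j + 1) t) * Complex.I_sq

/-- The odd generating functions of `seqW k 0` and `seqQ k 0` differ by that of `seqD k`. -/
theorem funQ_zero_eq (k : List ℕ) {t : ℝ} (ht : |t| < 1) :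
    funQ k 0 t = sinSubst t * evenSeries (seqW k 0) (sinSubst t) - funD k t := by
  have h := evenSeries_add (polyBounded_seqQ k 0) (polyBounded_seqD k) (abs_sinSubst_lt_one ht)
  have h1 : seqW k 0 = fun n => seqQ k 0 n + seqD k n := funext (seqW_zero_eq k)
  rw [funQ, funD, h1, h]
  ring

/-- The first integration against `dx / x` starts from `funQ k 0`, which is a combination of
`funP k / √(1 - x²)` and `funD k`. -/
theorem funQ_mem {k : List ℕ}
    (hP : (fun t => Complex.I * (funP k t : ℂ)) ∈ polylogSpan (coloredIndices 4 (k.sum + 1)))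
    (hD : (fun t => Complex.I * (funD k t : ℂ)) ∈ polylogSpan (coloredIndices 4 (k.sum + 1)))
    (m : ℕ) :
    (fun t => Complex.I * (funQ k (m + 1) t : ℂ)) ∈
      polylogSpan (coloredIndices 4 (k.sum + 1 + m + 1)) := by
  induction m with
  | zero =>
    refine ofReal_mem_polylogSpan subset_rfl Complex.I
      (fun t ht => hasDerivAt_sinSubst_mul_evenSeries (polyBounded_seqQ k 1)
        (mul_seqQ_succ k 0) ht) (by simp [funQ, sinSubst_zero])
      (primitivesIn_mono (polylogSpan_mono (convergentIndices_subset _ _))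
        (sub_mem (inv_mul_mem_primitivesIn four_ne_zero hP) (log_kernel_mem hD))) fun t ht => ?_
    have h0 := ofReal_ne_zero_of_mem_Ioo ht
    have h1 := one_add_sq_ne_zero t
    have ht' := abs_lt_one_of_mem_Ioo ht
    have h2 := funQ_zero_eq k ht'
    have h3 : evenSeries (seqQ k 0) (sinSubst t) =
        evenSeries (seqW k 0) (sinSubst t) - funD k t / sinSubst t := by
      have hx := (sinSubst_pos ht.1).ne'
      field_simp
      rw [funQ] at h2
      linear_combination h2
    simp only [Pi.sub_apply, funP]
    rw [h3, sinSubst_eq, cosSubst]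
    push_cast
    field_simp
  | succ m ih =>
    refine ofReal_mem_polylogSpan subset_rfl Complex.I
      (fun t ht => hasDerivAt_sinSubst_mul_evenSeries (polyBounded_seqQ k (m + 2))
        (mul_seqQ_succ k (m + 1)) ht) (by simp [funQ, sinSubst_zero])
      (primitivesIn_mono (polylogSpan_mono (convergentIndices_subset _ _)) (log_kernel_mem ih))
      fun t ht => ?_
    have h0 := ofReal_ne_zero_of_mem_Ioo ht
    have h1 := one_add_sq_ne_zero t
    simp only [funQ]
    rw [sinSubst_eq, cosSubst]
    push_cast
    field_simp

theorem funP_zero (k : List ℕ) : funP k 0 = 0 := by simp [funP, sinSubst_zero]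

theorem one_mem_polylogSpan : (fun _ : ℝ => (1 : ℂ)) ∈ polylogSpan (coloredIndices 4 0) :=
  Submodule.subset_span (Or.inl ⟨[], ⟨by simp, rfl⟩, rfl⟩)

theorem funP_nil_mem :
    (fun t => Complex.I * (funP [] t : ℂ)) ∈ polylogSpan (coloredIndices 4 1) := by
  have hs : PolyBounded (Pi.single 0 1 : ℕ → ℝ) := (polyBounded_const (1 : ℝ)).mono fun n => by
    by_cases h : n = 0
    · simp [h]
    · simp [Pi.single_eq_of_ne h]
  refine ofReal_mem_polylogSpan subset_rfl Complex.I
    (fun t ht => hasDerivAt_cosSubst_mul_sinSubst_mul_evenSeries (polyBounded_seqW [] 0) hs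
      (by simp [seqW, multipleTSum, arcsinSqCoeff_zero]) seqW_nil_rec ht) (funP_zero [])
    (primitivesIn_mono (polylogSpan_mono (convergentIndices_subset _ _))
      (arctan_kernel_mem one_mem_polylogSpan)) fun t ht => ?_
  have h1 : evenSeries (Pi.single 0 1 : ℕ → ℝ) (sinSubst t) = 1 := by
    rw [evenSeries, tsum_eq_single 0 fun n hn => by rw [Pi.single_eq_of_ne hn, mul_zero]]
    simp
  rw [h1]
  push_cast
  ring

/-- Removing the first entry `j` of `k` from `funP k` is an integration of `funQ _ (j - 1)` against
`dx / (x √(1 - x²))`, while `funD k` is `funQ _ j`; so the two are treated together. -/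
theorem funP_mem_and_funD_mem (k : List ℕ) (hk : ∀ a ∈ k, 0 < a) :
    (fun t => Complex.I * (funP k t : ℂ)) ∈ polylogSpan (coloredIndices 4 (k.sum + 1)) ∧
    (fun t => Complex.I * (funD k t : ℂ)) ∈ polylogSpan (coloredIndices 4 (k.sum + 1)) := by
  induction k with
  | nil =>
    refine ⟨funP_nil_mem, polylogSpan_congr (zero_mem _) fun t _ => ?_⟩
    simp [funD, seqD_nil, evenSeries]
  | cons j k ih =>
    obtain ⟨hP, hD⟩ := ih fun a ha => hk a (List.mem_cons_of_mem _ ha)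
    obtain ⟨j, rfl⟩ : ∃ i, j = i + 1 := ⟨j - 1, by have := hk j (by simp); lia⟩
    have hw : ((j + 1) :: k).sum + 1 = k.sum + 1 + j + 1 := by
      rw [List.sum_cons]
      ring
    have hd : ∀ t : ℝ, |t| < 1 → HasDerivAt (funP ((j + 1) :: k))
        (2 / (1 + t ^ 2) * evenSeries (seqQ k j) (sinSubst t)) t := fun t ht =>
      hasDerivAt_cosSubst_mul_sinSubst_mul_evenSeries (polyBounded_seqW _ 0)
        (polyBounded_seqQ k j) (seqW_cons_zero _ j k) (seqW_cons_rec j k) ht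
    -- In terms of `t`, the form `dx / (x √(1 - x²))` is `dt / t`.
    have hd' : ∀ t ∈ Ioo (0 : ℝ) 1,
        2 / (1 + t ^ 2) * evenSeries (seqQ k j) (sinSubst t) = t⁻¹ * funQ k j t := by
      intro t ht
      have := ht.1.ne'
      rw [funQ]
      nth_rewrite 2 [sinSubst_eq]
      field_simp
    rw [hw]
    constructor
    · cases j with
      | zero =>
        refine ofReal_mem_polylogSpan subset_rfl Complex.I hd (funP_zero _)
          (sub_mem (add_mem (primitivesIn_mono (polylogSpan_mono (convergentIndices_subset _ _))
            (inv_mul_mem_primitivesIn four_ne_zero hP)) (log_one_sub_sq_kernel_mem hP))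
            (primitivesIn_mono (polylogSpan_mono (convergentIndices_subset _ _))
              (inv_mul_mem_primitivesIn four_ne_zero hD))) fun t ht => ?_
        have h0 := ofReal_ne_zero_of_mem_Ioo ht
        have h1 := one_add_sq_ne_zero t
        have h2 := ofReal_one_sub_sq_ne_zero (abs_lt_one_of_mem_Ioo ht)
        rw [hd' t ht, funQ_zero_eq k (abs_lt_one_of_mem_Ioo ht)]
        simp only [Pi.sub_apply, Pi.add_apply, funP]
        rw [cosSubst]
        push_cast
        field_simp
        ring
      | succ j =>
        refine ofReal_mem_polylogSpan subset_rfl Complex.I hd (funP_zero _)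
          (primitivesIn_mono (polylogSpan_mono (convergentIndices_subset _ _))
            (inv_mul_mem_primitivesIn four_ne_zero (funQ_mem hP hD j))) fun t ht => ?_
        rw [hd' t ht]
        push_cast
        ring
    · have h : funD ((j + 1) :: k) = funQ k (j + 1) := by
        ext t
        rw [funD, funQ, seqD_cons]
      rw [h]
      exact funQ_mem hP hD j

/-- The generating function of the second series arises from `funP k` by one integration against
`dx / √(1 - x²)` and `m` integrations against `dx / x`. -/
theorem funW_mem (k : List ℕ) (hk : ∀ a ∈ k, 0 < a) (m : ℕ) :
    (fun t => (1 : ℂ) * (funW k (m + 1) t : ℂ)) ∈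
      polylogSpan (convergentIndices 4 (k.sum + 1 + m + 1)) := by
  induction m with
  | zero =>
    refine ofReal_mem_polylogSpan (convergentIndices_subset _ _) 1
      (fun t ht => hasDerivAt_sinSubst_sq_mul_evenSeries (polyBounded_seqW k 1)
        (mul_seqW_succ k 0) ht) (by simp [funW, sinSubst_zero])
      (neg_mem (arctan_kernel_mem (funP_mem_and_funD_mem k hk).1)) fun t ht => ?_
    simp only [Pi.neg_apply, funP]
    push_cast
    linear_combination (2 / (1 + (t : ℂ) ^ 2) * (cosSubst t * (sinSubst t *
      evenSeries (seqW k 0) (sinSubst t)))) * Complex.I_sq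
  | succ m ih =>
    refine ofReal_mem_polylogSpan (convergentIndices_subset _ _) 1
      (fun t ht => hasDerivAt_sinSubst_sq_mul_evenSeries (polyBounded_seqW k (m + 2))
        (mul_seqW_succ k (m + 1)) ht) (by simp [funW, sinSubst_zero])
      (log_kernel_mem (polylogSpan_mono (convergentIndices_subset _ _) ih)) fun t ht => ?_
    have h0 := ofReal_ne_zero_of_mem_Ioo ht
    have h1 := one_add_sq_ne_zero t
    simp only [funW]
    rw [sinSubst_eq, cosSubst]
    push_cast
    field_simp

/-! ### The two series -/

theorem seqA_nonneg (k : List ℕ) (m n : ℕ) : 0 ≤ seqA k m n :=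
  div_nonneg (mul_nonneg (arcsinCoeff_nonneg n) (multipleTSum_nonneg k n)) (by positivity)

theorem seqW_nonneg (k : List ℕ) (m n : ℕ) : 0 ≤ seqW k m n :=
  div_nonneg (mul_nonneg (arcsinSqCoeff_nonneg n) (multipleTSum_nonneg k (n + 1)))
    (by positivity)

theorem mainTheorem2 (m : ℕ) (hm : 0 < m) (k : List ℕ) (hk : ∀ a ∈ k, 0 < a) :
    (∃ c ∈ CMZV 4 (k.sum + m),
      HasSum (fun n : ℕ =>
        (((1 / (4 : ℝ) ^ n) * ((2 * n).choose n : ℝ) *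
          (multipleTSum k n / (2 * (n : ℝ) + 1) ^ m) : ℝ) : ℂ))
        (Complex.I * c)) ∧
    (∃ c ∈ CMZV 4 (k.sum + m + 1),
      HasSum (fun n : ℕ =>
        (((4 : ℝ) ^ (n + 1) / ((2 * (n + 1)).choose (n + 1) : ℝ) *
          (multipleTSum k (n + 1) / ((n : ℝ) + 1) ^ (m + 1)) : ℝ) : ℂ))
        c) := by
  obtain ⟨m, rfl⟩ : ∃ i, m = i + 1 := ⟨m - 1, by lia⟩
  constructor
  · obtain ⟨c, hc, hlim⟩ :=
      exists_tendsto_one_of_mem_polylogSpan four_ne_zero (funB_mem (funA_mem k hk) m)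
    refine ⟨-c, neg_mem hc, ?_⟩
    have h1 := hlim.const_mul (-Complex.I)
    have h2 : HasSum (fun n => (seqA k (m + 1) n : ℂ)) (-Complex.I * c) := by
      refine hasSum_of_tendsto_pow_mul_evenSeries (polyBounded_seqA k _) (seqA_nonneg k _) 1
        (h1.congr fun t => ?_)
      rw [pow_one, ← mul_assoc, neg_mul, Complex.I_mul_I, neg_neg, one_mul, funB]
    rw [mul_neg, ← neg_mul]
    refine h2.congr_fun fun n => ?_
    rw [seqA, arcsinCoeff, Nat.centralBinom]
    congr 1
    ring
  · obtain ⟨c, hc, hlim⟩ :=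
      exists_tendsto_one_of_mem_polylogSpan four_ne_zero (funW_mem k hk m)
    have h2 : HasSum (fun n => (seqW k (m + 1) n : ℂ)) c := by
      refine hasSum_of_tendsto_pow_mul_evenSeries (polyBounded_seqW k _) (seqW_nonneg k _) 2
        (hlim.congr fun t => ?_)
      rw [one_mul, funW]
    refine ⟨(2 ^ (m + 2) : ℚ) • c, ?_, ?_⟩
    · have hw : k.sum + (m + 1) + 1 = k.sum + 1 + m + 1 := by ring
      rw [hw]
      exact Submodule.smul_mem _ _ hc
    · refine (h2.const_smul (2 ^ (m + 2) : ℚ)).congr_fun fun n => ?_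
      have h3 : (2 * (n : ℝ) + 2) ^ (m + 2) = 2 ^ (m + 2) * ((n : ℝ) + 1) ^ (m + 2) := by
        rw [← mul_pow]
        ring
      have h4 : seqW k (m + 1) n = 4 ^ (n + 1) / ((2 * (n + 1)).choose (n + 1) : ℝ) *
          multipleTSum k (n + 1) / (2 * (n : ℝ) + 2) ^ (m + 2) := by
        rw [seqW, arcsinSqCoeff, Nat.centralBinom, pow_succ _ (m + 1)]
        field_simp
      rw [h4, h3, Rat.smul_def]
      push_cast
      field_simp
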